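/- Conventions. A mosaic floorplan with $n\ge 1$ rooms is a dissection of an axis-parallel rectangle into $n$ axis-parallel rectangles (rooms) such that no point is a corner of four rooms (no cross junctions). A room $a$ is directly to the left of a room $c$ if the right side of $a$ and the left side of $c$ lie on a common vertical segment of the dissection; "to the left of" is the transitive closure of this relation, and "above" is defined analogously with horizontal segments. Two dissections represent the same mosaic floorplan (are equivalent) if there is a bijection between their rooms that preserves the relations "to the left of" and "above". Top-left block deletion removes the room $b$ in the top-left corner: if the bottom-right corner of $b$ is a $\dashv$-junction (respectively a $\perp$-junction), the bottom (respectively right) edge of $b$ is shifted upwards (respectively leftwards) to the boundary of the bounding rectangle, pulling along the T-junctions attached to it; bottom-left block deletion is defined symmetrically. A mosaic floorplan $f$ with $n$ rooms corresponds to the permutation $\pi$ of $[n]$ obtained by labelling the rooms $1,\dots,n$ in the order in which repeated top-left deletion removes them and then listing the labels in the order in which repeated bottom-left deletion removes the rooms. A permutation $\pi$ of $[n]$ is Baxter if there are no indices $i<j<k<l$ with $\pi[k]<\pi[i]+1=\pi[l]<\pi[j]$ or $\pi[j]<\pi[i]=\pi[l]+1<\pi[k]$. Theorem. Let $n\ge1$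 and let $\pi$ be a Baxter permutation of $[n]$. There is a mosaic floorplan $f_\pi$, unique up to equivalence, corresponding to $\pi$, and the mosaic floorplan $f_{\pi^{-1}}$ corresponding to $\pi^{-1}$ is the mirror image of $f_\pi$ about the horizontal axis. More precisely, there is a mosaic floorplan $f_\pi$ such that a mosaic floorplan corresponds to $\pi$ if and only if it is equivalent to $f_\pi$, and corresponds to $\pi^{-1}$ if and only if it is equivalent to the mirror image of $f_\pi$ about the horizontal axis. -/

import Mathlib

/-- A permutation `π` of `[n]` is Baxter if there are no indices `i < j < k < l` with
`π[k] < π[i] + 1 = π[l] < π[j]` or `π[j] < π[i] = π[l] + 1 < π[k]`. -/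
def IsBaxter {n : ℕ} (π : Equiv.Perm (Fin n)) : Prop :=
  ∀ i j k l : Fin n, i < j → j < k → k < l →
    ¬ ((π k : ℕ) < (π i : ℕ) + 1 ∧ (π i : ℕ) + 1 = (π l : ℕ) ∧ (π l : ℕ) < (π j : ℕ)) ∧
    ¬ ((π j : ℕ) < (π i : ℕ) ∧ (π i : ℕ) = (π l : ℕ) + 1 ∧ (π l : ℕ) + 1 < (π k : ℕ))

/-- The data of an axis-parallel rectangle `[left, right] × [bottom, top]` in the plane
(first coordinate to the right, second coordinate upwards). -/
@[ext]
structure Rectangle where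
  left : ℝ
  right : ℝ
  bottom : ℝ
  top : ℝ

namespace Rectangle

/-- The rectangle has positive width and positive height. -/
def Nondegenerate (r : Rectangle) : Prop := r.left < r.right ∧ r.bottom < r.top

/-- The closed rectangle, as a set of points. -/
def region (r : Rectangle) : Set (ℝ × ℝ) := Set.Icc r.left r.right ×ˢ Set.Icc r.bottom r.top

/-- The open rectangle, as a set of points. -/
def inner (r : Rectangle) : Set (ℝ × ℝ) := Set.Ioo r.left r.right ×ˢ Set.Ioo r.bottom r.top

/-- The mirror image under the reflection `(x, y) ↦ (x, -y)` about the horizontal axis. -/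
def mirror (r : Rectangle) : Rectangle := ⟨r.left, r.right, -r.top, -r.bottom⟩

theorem mem_region_mirror (r : Rectangle) (p : ℝ × ℝ) :
    p ∈ r.mirror.region ↔ (p.1, -p.2) ∈ r.region := by
  simp only [region, mirror, Set.mem_prod, Set.mem_Icc]
  constructor <;> rintro ⟨⟨_, _⟩, _, _⟩ <;> refine ⟨⟨?_, ?_⟩, ?_, ?_⟩ <;> linarith

theorem mem_inner_mirror (r : Rectangle) (p : ℝ × ℝ) :
    p ∈ r.mirror.inner ↔ (p.1, -p.2) ∈ r.inner := by
  simp only [inner, mirror, Set.mem_prod, Set.mem_Ioo]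
  constructor <;> rintro ⟨⟨_, _⟩, _, _⟩ <;> refine ⟨⟨?_, ?_⟩, ?_, ?_⟩ <;> linarith

end Rectangle

/-- A mosaic floorplan with `n` rooms: a dissection of a bounding rectangle into `n` rectangular
rooms (every part of the dissection is one of the `n` rooms, so there are no empty rooms) without
cross junctions. The indexing of the rooms by `Fin n` is only a way to name them. -/
structure MosaicFloorplan (n : ℕ) where
  /-- the bounding rectangle -/
  box : Rectangle
  /-- the rooms -/
  room : Fin n → Rectangle
  box_nondegenerate : box.Nondegenerate
  room_nondegenerate : ∀ i, (room i).Nondegenerate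
  /-- distinct rooms do not overlap -/
  disjoint : ∀ i j, i ≠ j → Disjoint (room i).inner (room j).inner
  /-- the rooms fill the bounding rectangle -/
  cover : ⋃ i, (room i).region = box.region
  /-- no point is a corner of four rooms -/
  no_cross : ¬ ∃ (x y : ℝ) (a b c d : Fin n),
    ((room a).right = x ∧ (room a).bottom = y) ∧ ((room b).left = x ∧ (room b).bottom = y) ∧
    ((room c).right = x ∧ (room c).top = y) ∧ ((room d).left = x ∧ (room d).top = y)

/-! ### Block deletion and the permutation of a floorplan -/

/-- An intermediate state of the deletion process: the bounding rectangle, the (names of the)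
rooms that are still present, and their current shapes. -/
structure Layout (n : ℕ) where
  box : Rectangle
  rooms : Finset (Fin n)
  room : Fin n → Rectangle

namespace Layout

variable {n : ℕ}

/-- `b` is the top-left block. -/
def IsTopLeft (f : Layout n) (b : Fin n) : Prop :=
  b ∈ f.rooms ∧ (f.room b).left = f.box.left ∧ (f.room b).top = f.box.top

/-- `b` is the bottom-left block. -/
def IsBottomLeft (f : Layout n) (b : Fin n) : Prop :=
  b ∈ f.rooms ∧ (f.room b).left = f.box.left ∧ (f.room b).bottom = f.box.bottom

/-- The point `(r, y)`, where `r` is the right side of the block `b` and `y` is the height of its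
bottom (or top) edge, is a `⊣`-junction: the wall on the right side of `b` goes on
vertically past the height `y`, because it is the right side of the bounding rectangle or because
a single room lies to the right of the point. -/
def VerticalWallPasses (f : Layout n) (b : Fin n) (y : ℝ) : Prop :=
  f.box.bottom < y ∧ y < f.box.top ∧
    ((f.room b).right = f.box.right ∨
      ∃ c ∈ f.rooms, (f.room c).left = (f.room b).right ∧
        (f.room c).bottom < y ∧ y < (f.room c).top)

open Classical in
/-- Deletion of the top-left block `b`. If its bottom-right corner is a `⊣`-junction, its bottom
edge is shifted upwards to the top side of the bounding rectangle, and the rooms attached to that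
edge from below are stretched with it. Otherwise (the corner is a `⊥`-junction) its right edge is
shifted leftwards to the left side of the bounding rectangle, and the rooms attached to that edge
from the right are stretched with it. -/
noncomputable def deleteTopLeft (f : Layout n) (b : Fin n) : Layout n where
  box := f.box
  rooms := f.rooms.erase b
  room := fun i =>
    if f.VerticalWallPasses b (f.room b).bottom then
      if (f.room i).top = (f.room b).bottom ∧
          (f.room b).left ≤ (f.room i).left ∧ (f.room i).right ≤ (f.room b).right then
        { f.room i with top := f.box.top }
      else f.room i
    else
      if (f.room i).left = (f.room b).right ∧
          (f.room b).bottom ≤ (f.room i).bottom ∧ (f.room i).top ≤ (f.room b).top then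
        { f.room i with left := f.box.left }
      else f.room i

open Classical in
/-- Deletion of the bottom-left block `b`. If its top-right corner is a `⊣`-junction, its top
edge is shifted downwards to the bottom side of the bounding rectangle, and the rooms attached to
that edge from above are stretched with it. Otherwise (the corner is a `⊤`-junction) its right edge
is shifted leftwards to the left side of the bounding rectangle, and the rooms attached to that
edge from the right are stretched with it. -/
noncomputable def deleteBottomLeft (f : Layout n) (b : Fin n) : Layout n where
  box := f.box
  rooms := f.rooms.erase b
  room := fun i =>
    if f.VerticalWallPasses b (f.room b).top then
      if (f.room i).bottom = (f.room b).top ∧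
          (f.room b).left ≤ (f.room i).left ∧ (f.room i).right ≤ (f.room b).right then
        { f.room i with bottom := f.box.bottom }
      else f.room i
    else
      if (f.room i).left = (f.room b).right ∧
          (f.room b).bottom ≤ (f.room i).bottom ∧ (f.room i).top ≤ (f.room b).top then
        { f.room i with left := f.box.left }
      else f.room i

/-- The list consists of all rooms, in the order in which repeated deletion of the top-left block
removes them. -/
def IsTopLeftDeletionOrder : Layout n → List (Fin n) → Prop
  | f, [] => f.rooms = ∅
  | f, b :: l => f.IsTopLeft b ∧ (f.deleteTopLeft b).IsTopLeftDeletionOrder l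

/-- The list consists of all rooms, in the order in which repeated deletion of the bottom-left
block removes them. -/
def IsBottomLeftDeletionOrder : Layout n → List (Fin n) → Prop
  | f, [] => f.rooms = ∅
  | f, b :: l => f.IsBottomLeft b ∧ (f.deleteBottomLeft b).IsBottomLeftDeletionOrder l

end Layout

namespace MosaicFloorplan

variable {n : ℕ}

/-- The initial state of the deletion process: all rooms are present. -/
def toLayout (f : MosaicFloorplan n) : Layout n := ⟨f.box, Finset.univ, f.room⟩

/-- The floorplan `f` corresponds to the permutation `π`: if the rooms are labelled in their
top-left deletion order (`t k` is the `k`-th room of that order, so the label of a room `r` is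
`t.symm r`) and the labels are then listed in the bottom-left deletion order of the rooms
(`b i` is the `i`-th room of that order), the result is `π`. -/
def CorrespondsTo (f : MosaicFloorplan n) (π : Equiv.Perm (Fin n)) : Prop :=
  ∃ t b : Equiv.Perm (Fin n),
    f.toLayout.IsTopLeftDeletionOrder (List.ofFn t) ∧
    f.toLayout.IsBottomLeftDeletionOrder (List.ofFn b) ∧
    ∀ i, π i = t.symm (b i)

/-! ### Relative positions of rooms and equivalence of floorplans -/

/-- Room `a` lies directly to the left of room `c`: the right side of `a` and the left side of `c`
lie on a common vertical segment of the dissection (a line segment that meets no room's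
interior). -/
def DirectlyLeftOf (f : MosaicFloorplan n) (a c : Fin n) : Prop :=
  (f.room a).right = (f.room c).left ∧
    ∀ y ∈ Set.Icc (min (f.room a).bottom (f.room c).bottom) (max (f.room a).top (f.room c).top),
      ∀ i, ((f.room a).right, y) ∉ (f.room i).inner

/-- Room `a` lies directly above room `c`: the bottom side of `a` and the top side of `c`
lie on a common horizontal segment of the dissection. -/
def DirectlyAbove (f : MosaicFloorplan n) (a c : Fin n) : Prop :=
  (f.room a).bottom = (f.room c).top ∧
    ∀ x ∈ Set.Icc (min (f.room a).left (f.room c).left) (max (f.room a).right (f.room c).right),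
      ∀ i, (x, (f.room a).bottom) ∉ (f.room i).inner

/-- Room `a` is to the left of room `c`. -/
def LeftOf (f : MosaicFloorplan n) : Fin n → Fin n → Prop := Relation.TransGen f.DirectlyLeftOf

/-- Room `a` is above room `c`. -/
def Above (f : MosaicFloorplan n) : Fin n → Fin n → Prop := Relation.TransGen f.DirectlyAbove

/-- Two dissections represent the same mosaic floorplan if their rooms can be matched so that the
relative positions (left/right and above/below) agree. -/
def Equivalent (f g : MosaicFloorplan n) : Prop :=
  ∃ e : Equiv.Perm (Fin n), ∀ a c,
    (f.LeftOf a c ↔ g.LeftOf (e a) (e c)) ∧ (f.Above a c ↔ g.Above (e a) (e c))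

/-- The mirror image of a floorplan about the horizontal axis. -/
def mirror (f : MosaicFloorplan n) : MosaicFloorplan n where
  box := f.box.mirror
  room := fun i => (f.room i).mirror
  box_nondegenerate := ⟨f.box_nondegenerate.1, neg_lt_neg f.box_nondegenerate.2⟩
  room_nondegenerate := fun i =>
    ⟨(f.room_nondegenerate i).1, neg_lt_neg (f.room_nondegenerate i).2⟩
  disjoint := by
    intro i j hij
    rw [Set.disjoint_left]
    intro p hi hj
    rw [Rectangle.mem_inner_mirror] at hi hj
    exact Set.disjoint_left.1 (f.disjoint i j hij) hi hj
  cover := by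
    ext p
    have h := Set.ext_iff.1 f.cover (p.1, -p.2)
    simp only [Set.mem_iUnion] at h ⊢
    simp only [Rectangle.mem_region_mirror]
    exact h
  no_cross := by
    rintro ⟨x, y, a, b, c, d, ⟨ha, ha'⟩, ⟨hb, hb'⟩, ⟨hc, hc'⟩, hd, hd'⟩
    simp only [Rectangle.mirror] at ha ha' hb hb' hc hc' hd hd'
    exact f.no_cross ⟨x, -y, c, d, a, b, ⟨hc, by linarith⟩, ⟨hd, by linarith⟩,
      ⟨ha, by linarith⟩, hb, by linarith⟩

end MosaicFloorplan

/-! The theorem rests on recovering the relative positions of the rooms from the two deletion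
orders. The top-left room has nothing to its left and nothing above it, and its deletion preserves
dissections (`IsDissection.deleteTopLeft`) and leaves all adjacencies among the other rooms
unchanged (`directlyLeft_and_directlyAbove_deleteTopLeft`). Hence the top-left order is a linear
extension of both "left of" and "above". Reflection about the horizontal axis keeps "left of" and
reverses "above", so the bottom-left order extends "left of" and the reverse of "above".

Any two distinct rooms are related in one of the four ways (`IsDissection.comparable`). So `a` is
left of `c` exactly when it comes first in both orders, and above `c` exactly when it comes first in
the top-left order and second in the bottom-left order (`IsDissection.leftOf_and_above_iff`). The
permutation and the equivalence class therefore determine each other. The mirror image exchanges the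
two orders, which inverts the permutation.

For existence, put `p = π⁻¹` and grow a room around each cell of the diagonal of an `n × n` square.
This yields a floorplan for every permutation `p`. The Baxter condition guarantees that the order
pattern of each pair `j < k` is realised by a chain of adjacent rooms (`leftOf_floorplan`,
`above_floorplan`), and then the deletion orders can only be the identity and `π`. -/

namespace Rectangle

/-- The image under the reflection `(x, y) ↦ (-y, -x)`, which keeps the top-left corner. -/
def transpose (r : Rectangle) : Rectangle := ⟨-r.top, -r.bottom, -r.right, -r.left⟩

@[simp] theorem mirror_mirror (r : Rectangle) : r.mirror.mirror = r := by
  simp [mirror]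

@[simp] theorem transpose_transpose (r : Rectangle) : r.transpose.transpose = r := by
  simp [transpose]

end Rectangle

/-! ### Layouts, adjacency of rooms, and their behaviour under reflections. -/

namespace Layout

variable {n : ℕ}

/-- The mirror image of a layout about the horizontal axis. -/
def mirror (f : Layout n) : Layout n := ⟨f.box.mirror, f.rooms, fun i => (f.room i).mirror⟩

/-- The image of a layout under the reflection `(x, y) ↦ (-y, -x)`. -/
def transpose (f : Layout n) : Layout n :=
  ⟨f.box.transpose, f.rooms, fun i => (f.room i).transpose⟩

@[simp] theorem mirror_mirror (f : Layout n) : f.mirror.mirror = f := by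
  simp [mirror]

@[simp] theorem transpose_transpose (f : Layout n) : f.transpose.transpose = f := by
  simp [transpose]

/-- The rooms of the layout dissect the bounding rectangle, without cross junctions. -/
structure IsDissection (f : Layout n) : Prop where
  width_pos : ∀ i ∈ f.rooms, (f.room i).left < (f.room i).right
  height_pos : ∀ i ∈ f.rooms, (f.room i).bottom < (f.room i).top
  left_le : ∀ i ∈ f.rooms, f.box.left ≤ (f.room i).left
  right_le : ∀ i ∈ f.rooms, (f.room i).right ≤ f.box.right
  bottom_le : ∀ i ∈ f.rooms, f.box.bottom ≤ (f.room i).bottom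
  top_le : ∀ i ∈ f.rooms, (f.room i).top ≤ f.box.top
  separated : ∀ i ∈ f.rooms, ∀ j ∈ f.rooms, i ≠ j →
    (f.room i).right ≤ (f.room j).left ∨ (f.room j).right ≤ (f.room i).left ∨
    (f.room i).top ≤ (f.room j).bottom ∨ (f.room j).top ≤ (f.room i).bottom
  cover : f.rooms.Nonempty → ∀ x y, f.box.left ≤ x → x ≤ f.box.right →
    f.box.bottom ≤ y → y ≤ f.box.top → ∃ i ∈ f.rooms,
      ((f.room i).left ≤ x ∧ x ≤ (f.room i).right) ∧ (f.room i).bottom ≤ y ∧ y ≤ (f.room i).top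
  no_cross : ∀ x y, ∀ a ∈ f.rooms, ∀ b ∈ f.rooms, ∀ c ∈ f.rooms, ∀ d ∈ f.rooms,
    (f.room a).right = x → (f.room a).bottom = y → (f.room b).left = x → (f.room b).bottom = y →
    (f.room c).right = x → (f.room c).top = y → (f.room d).left = x → (f.room d).top = y → False

/-- The right side of `a` and the left side of `c` lie on a common vertical segment. -/
def DirectlyLeft (f : Layout n) (a c : Fin n) : Prop :=
  a ∈ f.rooms ∧ c ∈ f.rooms ∧ (f.room a).right = (f.room c).left ∧
    ∀ i ∈ f.rooms, (f.room i).left < (f.room a).right → (f.room a).right < (f.room i).right →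
      ((f.room i).top ≤ (f.room a).bottom ∧ (f.room i).top ≤ (f.room c).bottom) ∨
      ((f.room a).top ≤ (f.room i).bottom ∧ (f.room c).top ≤ (f.room i).bottom)

/-- The bottom side of `a` and the top side of `c` lie on a common horizontal segment. -/
def DirectlyAbove (f : Layout n) (a c : Fin n) : Prop :=
  a ∈ f.rooms ∧ c ∈ f.rooms ∧ (f.room a).bottom = (f.room c).top ∧
    ∀ i ∈ f.rooms, (f.room i).bottom < (f.room a).bottom → (f.room a).bottom < (f.room i).top →
      ((f.room i).right ≤ (f.room a).left ∧ (f.room i).right ≤ (f.room c).left) ∨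
      ((f.room a).right ≤ (f.room i).left ∧ (f.room c).right ≤ (f.room i).left)

theorem directlyLeft_mirror (f : Layout n) (a c : Fin n) :
    f.mirror.DirectlyLeft a c ↔ f.DirectlyLeft a c := by
  simp only [DirectlyLeft, mirror, Rectangle.mirror, neg_le_neg_iff]
  grind

theorem directlyAbove_mirror (f : Layout n) (a c : Fin n) :
    f.mirror.DirectlyAbove a c ↔ f.DirectlyAbove c a := by
  simp only [DirectlyAbove, mirror, Rectangle.mirror, neg_lt_neg_iff, neg_inj]
  grind

theorem directlyLeft_transpose (f : Layout n) (a c : Fin n) :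
    f.transpose.DirectlyLeft a c ↔ f.DirectlyAbove a c := by
  simp only [DirectlyAbove, DirectlyLeft, transpose, Rectangle.transpose, neg_lt_neg_iff, neg_inj,
    neg_le_neg_iff]
  grind

theorem directlyAbove_transpose (f : Layout n) (a c : Fin n) :
    f.transpose.DirectlyAbove a c ↔ f.DirectlyLeft a c := by
  rw [← directlyLeft_transpose, transpose_transpose]

theorem IsDissection.mirror {f : Layout n} (hf : f.IsDissection) : f.mirror.IsDissection where
  width_pos := hf.width_pos
  height_pos i hi := neg_lt_neg (hf.height_pos i hi)
  left_le := hf.left_le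
  right_le := hf.right_le
  bottom_le i hi := neg_le_neg (hf.top_le i hi)
  top_le i hi := neg_le_neg (hf.bottom_le i hi)
  separated i hi j hj h := by
    have := hf.separated i hi j hj h
    simp only [Layout.mirror, Rectangle.mirror, neg_le_neg_iff]
    tauto
  cover hne x y h1 h2 h3 h4 := by
    simp only [Layout.mirror, Rectangle.mirror] at h1 h2 h3 h4
    obtain ⟨i, hi, hx, hy, hy'⟩ := hf.cover hne x (-y) h1 h2 (by linarith) (by linarith)
    refine ⟨i, hi, hx, ?_, ?_⟩ <;> simp only [Layout.mirror, Rectangle.mirror] <;> linarith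
  no_cross x y a ha b hb c hc d hd h1 h2 h3 h4 h5 h6 h7 h8 := by
    simp only [Layout.mirror, Rectangle.mirror] at h1 h2 h3 h4 h5 h6 h7 h8
    exact hf.no_cross x (-y) c hc d hd a ha b hb h5 (by linarith) h7 (by linarith) h1
      (by linarith) h3 (by linarith)

theorem IsDissection.transpose {f : Layout n} (hf : f.IsDissection) :
    f.transpose.IsDissection where
  width_pos i hi := neg_lt_neg (hf.height_pos i hi)
  height_pos i hi := neg_lt_neg (hf.width_pos i hi)
  left_le i hi := neg_le_neg (hf.top_le i hi)
  right_le i hi := neg_le_neg (hf.bottom_le i hi)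
  bottom_le i hi := neg_le_neg (hf.right_le i hi)
  top_le i hi := neg_le_neg (hf.left_le i hi)
  separated i hi j hj h := by
    have := hf.separated i hi j hj h
    simp only [Layout.transpose, Rectangle.transpose, neg_le_neg_iff]
    tauto
  cover hne x y h1 h2 h3 h4 := by
    simp only [Layout.transpose, Rectangle.transpose] at h1 h2 h3 h4
    obtain ⟨i, hi, ⟨hx, hx'⟩, hy, hy'⟩ := hf.cover hne (-y) (-x) (by linarith) (by linarith)
      (by linarith) (by linarith)
    refine ⟨i, hi, ⟨?_, ?_⟩, ?_, ?_⟩ <;> simp only [Layout.transpose, Rectangle.transpose] <;>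
      linarith
  no_cross x y a ha b hb c hc d hd h1 h2 h3 h4 h5 h6 h7 h8 := by
    simp only [Layout.transpose, Rectangle.transpose] at h1 h2 h3 h4 h5 h6 h7 h8
    refine hf.no_cross (-y) (-x) a ha c hc b hb d hd ?_ ?_ ?_ ?_ ?_ ?_ ?_ ?_ <;> linarith

/-! ### Rooms around a given point. -/

namespace IsDissection

variable {f : Layout n}

-- Covering by closed rooms does not say on which side of a point a room lies. Apply it to the point
-- moved diagonally by a small `ε`: as there are finitely many rooms, `ε` can be chosen so that no
-- left or bottom side is passed on the way. The other directions follow by reflection.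
open Filter Topology in
theorem exists_room_up_right (hf : f.IsDissection) (hne : f.rooms.Nonempty) {x y : ℝ}
    (h1 : f.box.left ≤ x) (h2 : x < f.box.right) (h3 : f.box.bottom ≤ y) (h4 : y < f.box.top) :
    ∃ i ∈ f.rooms, (f.room i).left ≤ x ∧ x < (f.room i).right ∧
      (f.room i).bottom ≤ y ∧ y < (f.room i).top := by
  have key : ∀ z w : ℝ, ∀ᶠ ε in 𝓝[>] (0 : ℝ), w ≤ z + ε → w ≤ z := by
    intro z w
    rcases le_or_gt w z with h | h
    · exact Eventually.of_forall fun _ _ => h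
    · filter_upwards [Ioo_mem_nhdsGT (sub_pos.2 h)] with ε hε hw
      linarith [hε.2]
  have hx : ∀ᶠ ε in 𝓝[>] (0 : ℝ), ∀ i ∈ f.rooms,
      (f.room i).left ≤ x + ε → (f.room i).left ≤ x :=
    (Filter.eventually_all_finset _).2 fun i _ => key x _
  have hy : ∀ᶠ ε in 𝓝[>] (0 : ℝ), ∀ i ∈ f.rooms,
      (f.room i).bottom ≤ y + ε → (f.room i).bottom ≤ y :=
    (Filter.eventually_all_finset _).2 fun i _ => key y _
  have hw : ∀ w : ℝ, 0 < w → ∀ᶠ ε in 𝓝[>] (0 : ℝ), ε ∈ Set.Ioo 0 w := fun w h =>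
    Ioo_mem_nhdsGT h
  obtain ⟨ε, ⟨hε1, hε2⟩, hε3, hx, hy⟩ :=
    ((hw _ (sub_pos.2 h2)).and ((hw _ (sub_pos.2 h4)).and (hx.and hy))).exists
  obtain ⟨i, hi, ⟨hl, hr⟩, hb, ht⟩ := hf.cover hne (x + ε) (y + ε) (by linarith) (by linarith)
    (by linarith) (by linarith [hε3.2])
  exact ⟨i, hi, hx i hi hl, by linarith, hy i hi hb, by linarith⟩

theorem exists_room_down_right (hf : f.IsDissection) (hne : f.rooms.Nonempty) {x y : ℝ}
    (h1 : f.box.left ≤ x) (h2 : x < f.box.right) (h3 : f.box.bottom < y) (h4 : y ≤ f.box.top) :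
    ∃ i ∈ f.rooms, (f.room i).left ≤ x ∧ x < (f.room i).right ∧
      (f.room i).bottom < y ∧ y ≤ (f.room i).top := by
  obtain ⟨i, hi, hl, hr, hb, ht⟩ := hf.mirror.exists_room_up_right hne (x := x) (y := -y) h1 h2
    (neg_le_neg h4) (neg_lt_neg h3)
  exact ⟨i, hi, hl, hr, neg_lt_neg_iff.1 ht, neg_le_neg_iff.1 hb⟩

theorem exists_room_down_left (hf : f.IsDissection) (hne : f.rooms.Nonempty) {x y : ℝ}
    (h1 : f.box.left < x) (h2 : x ≤ f.box.right) (h3 : f.box.bottom < y) (h4 : y ≤ f.box.top) :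
    ∃ i ∈ f.rooms, (f.room i).left < x ∧ x ≤ (f.room i).right ∧
      (f.room i).bottom < y ∧ y ≤ (f.room i).top := by
  obtain ⟨i, hi, hl, hr, hb, ht⟩ := hf.transpose.exists_room_up_right hne (x := -y) (y := -x)
    (neg_le_neg h4) (neg_lt_neg h3) (neg_le_neg h2) (neg_lt_neg h1)
  exact ⟨i, hi, neg_lt_neg_iff.1 ht, neg_le_neg_iff.1 hb, neg_lt_neg_iff.1 hr,
    neg_le_neg_iff.1 hl⟩

theorem exists_isTopLeft (hf : f.IsDissection) (hne : f.rooms.Nonempty) :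
    ∃ b, f.IsTopLeft b := by
  obtain ⟨j, hj⟩ := hne
  have := hf.width_pos j hj
  have := hf.height_pos j hj
  have := hf.left_le j hj
  have := hf.right_le j hj
  have := hf.bottom_le j hj
  have := hf.top_le j hj
  obtain ⟨i, hi, hl, -, -, ht⟩ := hf.exists_room_down_right ⟨j, hj⟩ (x := f.box.left)
    (y := f.box.top) le_rfl (by linarith) (by linarith) le_rfl
  exact ⟨i, hi, le_antisymm hl (hf.left_le i hi), le_antisymm (hf.top_le i hi) ht⟩

end IsDissection

/-! ### The upward shift, and the leftward shift as its reflection. -/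

/-- Removal of the top-left block `b` by shifting its bottom edge upwards. -/
noncomputable def shiftUp (f : Layout n) (b : Fin n) : Layout n where
  box := f.box
  rooms := f.rooms.erase b
  room := fun i =>
    open Classical in
    if (f.room i).top = (f.room b).bottom ∧
        (f.room b).left ≤ (f.room i).left ∧ (f.room i).right ≤ (f.room b).right then
      { f.room i with top := f.box.top }
    else f.room i

theorem shiftUp_room_cases (f : Layout n) (b i : Fin n) :
    ((f.room i).top = (f.room b).bottom ∧ (f.room b).left ≤ (f.room i).left ∧
      (f.room i).right ≤ (f.room b).right ∧ ((f.shiftUp b).room i).top = f.box.top) ∨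
    (¬ ((f.room i).top = (f.room b).bottom ∧ (f.room b).left ≤ (f.room i).left ∧
      (f.room i).right ≤ (f.room b).right) ∧ ((f.shiftUp b).room i).top = (f.room i).top) := by
  simp only [shiftUp]
  split_ifs with h
  · exact Or.inl ⟨h.1, h.2.1, h.2.2, rfl⟩
  · exact Or.inr ⟨h, rfl⟩

@[simp] theorem shiftUp_room_left (f : Layout n) (b i : Fin n) :
    ((f.shiftUp b).room i).left = (f.room i).left := by
  simp only [shiftUp]; split_ifs <;> rfl

@[simp] theorem shiftUp_room_right (f : Layout n) (b i : Fin n) :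
    ((f.shiftUp b).room i).right = (f.room i).right := by
  simp only [shiftUp]; split_ifs <;> rfl

@[simp] theorem shiftUp_room_bottom (f : Layout n) (b i : Fin n) :
    ((f.shiftUp b).room i).bottom = (f.room i).bottom := by
  simp only [shiftUp]; split_ifs <;> rfl

@[simp] theorem shiftUp_box (f : Layout n) (b : Fin n) : (f.shiftUp b).box = f.box := rfl

@[simp] theorem shiftUp_rooms (f : Layout n) (b : Fin n) :
    (f.shiftUp b).rooms = f.rooms.erase b := rfl

theorem deleteTopLeft_of_passes {f : Layout n} {b : Fin n}
    (h : f.VerticalWallPasses b (f.room b).bottom) : f.deleteTopLeft b = f.shiftUp b := by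
  simp [deleteTopLeft, shiftUp, h]

/-- The reflection fixes the top-left corner and exchanges the bottom and right edges of `b`, so
only the upward shift has to be analysed. -/
theorem deleteTopLeft_of_not_passes {f : Layout n} {b : Fin n}
    (h : ¬ f.VerticalWallPasses b (f.room b).bottom) :
    f.deleteTopLeft b = (f.transpose.shiftUp b).transpose := by
  simp only [deleteTopLeft, shiftUp, h, transpose, if_false, Layout.mk.injEq,
    Rectangle.transpose_transpose, true_and]
  funext i
  simp only [Rectangle.transpose, neg_inj, neg_le_neg_iff]
  have : ((f.room i).left = (f.room b).right ∧ (f.room b).bottom ≤ (f.room i).bottom ∧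
      (f.room i).top ≤ (f.room b).top) ↔ ((f.room i).left = (f.room b).right ∧
      (f.room i).top ≤ (f.room b).top ∧ (f.room b).bottom ≤ (f.room i).bottom) := by tauto
  simp only [this]
  split_ifs <;> simp

end Layout

/-! ### Top-left deletion preserves dissections and adjacencies. -/

namespace Layout

variable {n : ℕ} {f : Layout n} {b : Fin n}

/-- This is where the absence of cross junctions enters: if neither wall went straight through the
bottom-right corner of `b`, four rooms would have a corner there. A second room is needed because
otherwise that corner is a corner of the box. -/
theorem VerticalWallPasses.transpose_of_not (hf : f.IsDissection) (hb : f.IsTopLeft b)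
    (hne : (f.rooms.erase b).Nonempty) (h : ¬ f.VerticalWallPasses b (f.room b).bottom) :
    f.transpose.VerticalWallPasses b (f.transpose.room b).bottom := by
  obtain ⟨j, hj⟩ := hne
  obtain ⟨hjb, hj⟩ := Finset.mem_erase.1 hj
  obtain ⟨hb, hbl, hbt⟩ := hb
  have hR : ∀ i ∈ f.rooms, f.box.left < f.box.right ∧ f.box.bottom < f.box.top := fun i hi =>
    ⟨((hf.left_le i hi).trans_lt (hf.width_pos i hi)).trans_le (hf.right_le i hi),
      ((hf.bottom_le i hi).trans_lt (hf.height_pos i hi)).trans_le (hf.top_le i hi)⟩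
  have hw := hf.width_pos
  have hh := hf.height_pos
  have sep := hf.separated
  have b1 := hw b hb
  have b2 := hh b hb
  have b3 := hf.right_le b hb
  have b4 := hf.bottom_le b hb
  simp only [VerticalWallPasses, Layout.transpose, Rectangle.transpose, neg_lt_neg_iff, neg_inj]
  simp only [VerticalWallPasses, not_and, not_or, not_exists] at h
  rcases b4.eq_or_lt with h0 | h0
  · refine ⟨?_, by linarith, Or.inl h0.symm⟩
    by_contra hcon
    have j1 := hw j hj
    have j2 := hh j hj
    have j3 := hf.left_le j hj
    have j4 := hf.right_le j hj
    have j5 := hf.bottom_le j hj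
    have j6 := hf.top_le j hj
    rcases sep j hj b hb hjb with h | h | h | h <;> linarith
  · obtain ⟨h1, h2⟩ := h h0 (by linarith)
    have b5 := lt_of_le_of_ne b3 h1
    refine ⟨b5, by linarith, Or.inr ?_⟩
    by_contra! hcon
    -- The rooms `c₁`, `c₂`, `c₃` lie to the lower left, lower right and upper right of the corner;
    -- with `b` they form the cross.
    obtain ⟨c₁, m₁, l₁, r₁, d₁, t₁⟩ := hf.exists_room_down_left ⟨b, hb⟩
      (x := (f.room b).right) (y := (f.room b).bottom) (by linarith) b3 h0 (by linarith)
    obtain ⟨c₂, m₂, l₂, r₂, d₂, t₂⟩ := hf.exists_room_down_right ⟨b, hb⟩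
      (x := (f.room b).right) (y := (f.room b).bottom) (by linarith) b5 h0 (by linarith)
    obtain ⟨c₃, m₃, l₃, r₃, d₃, t₃⟩ := hf.exists_room_up_right ⟨b, hb⟩
      (x := (f.room b).right) (y := (f.room b).bottom) (by linarith) b5 h0.le (by linarith)
    have e₁ : (f.room c₁).top = (f.room b).bottom := by
      rcases eq_or_ne c₁ b with rfl | hn
      · linarith
      rcases sep c₁ m₁ b hb hn with h | h | h | h <;> linarith [hf.left_le c₁ m₁]
    have e₂ : (f.room c₁).right = (f.room b).right := by
      by_contra hn
      exact absurd (hcon c₁ m₁ e₁ (lt_of_le_of_ne r₁ (Ne.symm hn))) (by linarith)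
    have e₃ : (f.room c₂).left = (f.room b).right := by
      rcases eq_or_ne c₁ c₂ with rfl | hn
      · linarith
      rcases sep c₁ m₁ c₂ m₂ hn with h | h | h | h <;> linarith
    have e₄ : (f.room c₂).top = (f.room b).bottom := by
      by_contra hn
      exact h2 c₂ m₂ e₃ d₂ (lt_of_le_of_ne t₂ (Ne.symm hn))
    have e₅ : (f.room c₃).left = (f.room b).right := by
      rcases eq_or_ne c₃ b with rfl | hn
      · linarith
      rcases sep c₃ m₃ b hb hn with h | h | h | h <;> linarith
    have e₆ : (f.room c₃).bottom = (f.room b).bottom := by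
      by_contra hn
      exact h2 c₃ m₃ e₅ (lt_of_le_of_ne d₃ hn) t₃
    exact hf.no_cross _ _ b hb c₃ m₃ c₁ m₁ c₂ m₂ rfl rfl e₅ e₆ e₂ e₁ e₃ e₄

theorem IsTopLeft.transpose (hb : f.IsTopLeft b) : f.transpose.IsTopLeft b :=
  ⟨hb.1, congrArg Neg.neg hb.2.2, congrArg Neg.neg hb.2.1⟩

/-- A room touching the extension of the bottom edge of `b` from below ends before the wall on the
right side of `b`, or starts behind it. -/
theorem VerticalWallPasses.right_le_or_right_le_left (hf : f.IsDissection)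
    (hp : f.VerticalWallPasses b (f.room b).bottom) {k : Fin n} (hk : k ∈ f.rooms)
    (h₁ : (f.room k).bottom ≤ (f.room b).bottom) (h₂ : (f.room b).bottom ≤ (f.room k).top) :
    (f.room k).right ≤ (f.room b).right ∨ (f.room b).right ≤ (f.room k).left := by
  obtain ⟨-, -, h | ⟨c, hc, c₁, c₂, c₃⟩⟩ := hp
  · exact Or.inl (h ▸ hf.right_le k hk)
  · rcases eq_or_ne k c with rfl | hn
    · exact Or.inr c₁.ge
    rcases hf.separated k hk c hc hn with h | h | h | h
    · exact Or.inl (by linarith)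
    · exact Or.inr (by linarith [hf.width_pos c hc])
    · linarith
    · linarith

/-- The wall on the right of `b` stops every room under the bottom edge from protruding beyond it,
so the stretched rooms fill exactly the place of `b`. -/
theorem IsDissection.shiftUp (hf : f.IsDissection) (hb : f.IsTopLeft b)
    (hp : f.VerticalWallPasses b (f.room b).bottom) : (f.shiftUp b).IsDissection := by
  have hp' := @VerticalWallPasses.right_le_or_right_le_left _ f b hf hp
  obtain ⟨hb, hbl, hbt⟩ := hb
  have b1 := hf.width_pos b hb
  have b2 := hf.height_pos b hb
  have b3 := hf.right_le b hb
  have sep := hf.separated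
  have hcase := f.shiftUp_room_cases b
  constructor
  · simpa using fun i _ hi => hf.width_pos i hi
  · intro i hi
    simp only [shiftUp_rooms, Finset.mem_erase] at hi
    have := hf.height_pos i hi.2
    have := hf.top_le i hi.2
    rcases hcase i with h | h <;> simp only [shiftUp_room_bottom, h] <;> linarith
  · simpa using fun i _ hi => hf.left_le i hi
  · simpa using fun i _ hi => hf.right_le i hi
  · simpa using fun i _ hi => hf.bottom_le i hi
  · intro i hi
    simp only [shiftUp_rooms, Finset.mem_erase] at hi
    have := hf.top_le i hi.2
    rcases hcase i with h | h <;> simp [h, this]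
  · intro i hi j hj hij
    simp only [shiftUp_rooms, Finset.mem_erase] at hi hj
    have s₁ := sep i hi.2 j hj.2 hij
    have s₂ := sep i hi.2 b hb hi.1
    have s₃ := sep j hj.2 b hb hj.1
    have := hf.left_le i hi.2
    have := hf.left_le j hj.2
    have := hf.top_le i hi.2
    have := hf.top_le j hj.2
    have := hf.height_pos i hi.2
    have := hf.height_pos j hj.2
    have := hf.width_pos i hi.2
    have := hf.width_pos j hj.2
    simp only [shiftUp_room_left, shiftUp_room_right, shiftUp_room_bottom]
    have := hcase i
    have := hcase j
    grind
  · rintro - x y h1 h2 h3 h4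
    obtain ⟨i, hi, hx, hy⟩ := hf.cover ⟨b, hb⟩ x y h1 h2 h3 h4
    simp only [shiftUp_box] at h1 h2 h3 h4
    simp only [shiftUp_rooms, Finset.mem_erase, shiftUp_room_left, shiftUp_room_right,
      shiftUp_room_bottom]
    rcases eq_or_ne i b with rfl | hib
    · obtain ⟨k, hk, k₁, k₂, k₃, k₄, k₅, k₆⟩ : ∃ k ∈ f.rooms, (f.room k).left ≤ x ∧
          x ≤ (f.room k).right ∧ (f.room k).bottom < (f.room i).bottom ∧
          (f.room i).bottom ≤ (f.room k).top ∧ (f.room k).left < (f.room i).right ∧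
          (f.room i).left < (f.room k).right := by
        -- A point of `b` is taken over by the room under the bottom edge at the same abscissa. On
        -- the right side of `b` that room has to be sought to the left.
        rcases hx.2.eq_or_lt with h | h
        · obtain ⟨k, hk, k₁, k₂, k₃, k₄⟩ := hf.exists_room_down_left ⟨i, hi⟩ (x := x)
            (y := (f.room i).bottom) (by linarith) h2 hp.1 (by linarith)
          exact ⟨k, hk, k₁.le, k₂, k₃, k₄, by linarith, by linarith⟩
        · obtain ⟨k, hk, k₁, k₂, k₃, k₄⟩ := hf.exists_room_down_right ⟨i, hi⟩ (x := x)
            (y := (f.room i).bottom) h1 (by linarith) hp.1 (by linarith)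
          exact ⟨k, hk, k₁, k₂.le, k₃, k₄, by linarith, by linarith⟩
      have hki : k ≠ i := by rintro rfl; exact lt_irrefl _ k₃
      have e₁ : (f.room k).top = (f.room i).bottom := by
        rcases sep k hk i hi hki with h | h | h | h <;> linarith [hf.left_le k hk]
      have e₂ : (f.room k).right ≤ (f.room i).right := by
        rcases hp' hk k₃.le k₄ with h | h <;> linarith
      refine ⟨k, ⟨hki, hk⟩, ⟨k₁, k₂⟩, by linarith, ?_⟩
      rcases hcase k with h | h
      · linarith
      · exact absurd ⟨e₁, by linarith [hf.left_le k hk], e₂⟩ h.1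
    · refine ⟨i, ⟨hib, hi⟩, hx, hy.1, ?_⟩
      rcases hcase i with h | h <;> linarith
  · intro x y a ha b' hb' c hc d hd h1 h2 h3 h4 h5 h6 h7 h8
    simp only [shiftUp_rooms, Finset.mem_erase] at ha hb' hc hd
    simp only [shiftUp_room_left, shiftUp_room_right, shiftUp_room_bottom] at h1 h2 h3 h4 h5 h7
    have := hf.height_pos a ha.2
    have := hf.top_le a ha.2
    -- The room `a` lies above height `y`, so `y` is below the top of the box and the tops of `c`
    -- and `d` at this height were not moved.
    refine hf.no_cross x y a ha.2 b' hb'.2 c hc.2 d hd.2 h1 h2 h3 h4 h5 ?_ h7 ?_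
    · rcases hcase c with h | h <;> linarith
    · rcases hcase d with h | h <;> linarith

/-- Abscissas do not change. If a wall would run into `b` or into a stretched room, the rooms along
it are compared with `b`: those touching a line strictly within the width of `b` lie below `b`. -/
theorem directlyLeft_shiftUp (hf : f.IsDissection) (hb : f.IsTopLeft b) {a c : Fin n}
    (ha : a ≠ b) (hc : c ≠ b) : (f.shiftUp b).DirectlyLeft a c ↔ f.DirectlyLeft a c := by
  obtain ⟨hb, hbl, hbt⟩ := hb
  have b1 := hf.width_pos b hb
  have b2 := hf.height_pos b hb
  have sep := hf.separated
  have hcase := f.shiftUp_room_cases b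
  simp only [DirectlyLeft, shiftUp_rooms, Finset.mem_erase, shiftUp_room_left,
    shiftUp_room_right, shiftUp_room_bottom, ne_eq, ha, hc, not_false_eq_true, true_and]
  refine and_congr_right fun ha' => and_congr_right fun hc' => and_congr_right fun hac => ?_
  have a1 := hf.width_pos a ha'
  have a2 := hf.height_pos a ha'
  have a3 := sep a ha' b hb ha
  have a4 := hf.left_le a ha'
  have a5 := hf.top_le a ha'
  have c1 := hf.width_pos c hc'
  have c2 := hf.height_pos c hc'
  have c3 := sep c hc' b hb hc
  have c4 := hf.left_le c hc'
  have c5 := hf.top_le c hc'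
  have ac := hcase a
  have cc := hcase c
  constructor
  · intro h i hi hl hr
    rcases eq_or_ne i b with rfl | hib
    · right
      constructor
      · rcases a3 with h | h | h | h <;> linarith
      · rcases c3 with h | h | h | h <;> linarith
    · have := h i ⟨hib, hi⟩ hl hr
      have := hcase i
      have := hf.top_le i hi
      grind
  · rintro h i ⟨hib, hi⟩ hl hr
    have := h i hi hl hr
    have := hcase i
    have := hf.top_le i hi
    have := hf.left_le i hi
    have := hf.height_pos i hi
    have := hf.width_pos i hi
    have := sep i hi b hb hib
    grind

/-- Only adjacencies along the vanishing bottom edge of `b` are at risk. Apart from `b` no room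
stands on that segment, since it ends at the wall on the right of `b`. -/
theorem directlyAbove_shiftUp (hf : f.IsDissection) (hb : f.IsTopLeft b)
    (hp : f.VerticalWallPasses b (f.room b).bottom) {a c : Fin n}
    (ha : a ≠ b) (hc : c ≠ b) : (f.shiftUp b).DirectlyAbove a c ↔ f.DirectlyAbove a c := by
  have hp' := @VerticalWallPasses.right_le_or_right_le_left _ f b hf hp
  obtain ⟨hb, hbl, hbt⟩ := hb
  have b1 := hf.width_pos b hb
  have b2 := hf.height_pos b hb
  have sep := hf.separated
  have hcase := f.shiftUp_room_cases b
  simp only [DirectlyAbove, shiftUp_rooms, Finset.mem_erase, shiftUp_room_left,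
    shiftUp_room_right, shiftUp_room_bottom, ne_eq, ha, hc, not_false_eq_true, true_and]
  refine and_congr_right fun ha' => and_congr_right fun hc' => ?_
  have a1 := hf.width_pos a ha'
  have a2 := hf.height_pos a ha'
  have a3 := sep a ha' b hb ha
  have a4 := hf.left_le a ha'
  have a5 := hf.top_le a ha'
  have c1 := hf.width_pos c hc'
  have c2 := hf.height_pos c hc'
  have c3 := sep c hc' b hb hc
  have c4 := hf.left_le c hc'
  have c5 := hf.top_le c hc'
  have cc := hcase c
  constructor
  · rintro ⟨hac, h⟩
    have hct : ((f.shiftUp b).room c).top = (f.room c).top := by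
      rcases cc with h | h
      · linarith
      · exact h.2
    refine ⟨by rw [hac, hct], fun i hi hl hr => ?_⟩
    rcases eq_or_ne i b with rfl | hib
    · grind
    · refine h i ⟨hib, hi⟩ hl ?_
      have := hf.top_le i hi
      rcases hcase i with h | h <;> linarith
  · rintro ⟨hac, h⟩
    have hct : ((f.shiftUp b).room c).top = (f.room c).top := by
      rcases cc with h' | h'
      · exfalso
        obtain ⟨-, -, hr | ⟨k, hk, k₁, k₂, k₃⟩⟩ := hp
        · have := hf.right_le a ha'
          rcases a3 with h | h | h | h <;> linarith
        · have := h k hk (by linarith) (by linarith)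
          have := hf.width_pos k hk
          grind
      · exact h'.2
    refine ⟨by rw [hac, hct], ?_⟩
    rintro i ⟨hib, hi⟩ hl hr
    have := h i hi hl
    have := hcase i
    have := hf.top_le i hi
    have := hp' hc'
    have := hf.height_pos i hi
    grind

end Layout

namespace Layout

variable {n : ℕ} {f : Layout n} {b : Fin n}

theorem IsDissection.deleteTopLeft (hf : f.IsDissection) (hb : f.IsTopLeft b) :
    (f.deleteTopLeft b).IsDissection := by
  by_cases hp : f.VerticalWallPasses b (f.room b).bottom
  · rw [deleteTopLeft_of_passes hp]
    exact hf.shiftUp hb hp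
  -- A sole room has no junction at its corner; its deletion leaves the empty layout, for which all
  -- conditions are vacuous.
  · rcases (f.rooms.erase b).eq_empty_or_nonempty with he | hne
    · have he : (f.deleteTopLeft b).rooms = ∅ := he
      constructor <;> simp [he]
    · rw [deleteTopLeft_of_not_passes hp]
      exact (hf.transpose.shiftUp hb.transpose
        (VerticalWallPasses.transpose_of_not hf hb hne hp)).transpose

theorem directlyLeft_and_directlyAbove_deleteTopLeft (hf : f.IsDissection) (hb : f.IsTopLeft b)
    {a c : Fin n} (ha : a ≠ b) (hc : c ≠ b) :
    ((f.deleteTopLeft b).DirectlyLeft a c ↔ f.DirectlyLeft a c) ∧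
    ((f.deleteTopLeft b).DirectlyAbove a c ↔ f.DirectlyAbove a c) := by
  by_cases hp : f.VerticalWallPasses b (f.room b).bottom
  · rw [deleteTopLeft_of_passes hp]
    exact ⟨directlyLeft_shiftUp hf hb ha hc, directlyAbove_shiftUp hf hb hp ha hc⟩
  · rcases (f.rooms.erase b).eq_empty_or_nonempty with he | hne
    · have he' : a ∉ f.rooms := fun h =>
        Finset.notMem_empty a (he ▸ Finset.mem_erase.2 ⟨ha, h⟩)
      have he : a ∉ (f.deleteTopLeft b).rooms := fun h => he' (Finset.mem_of_mem_erase h)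
      simp [DirectlyLeft, DirectlyAbove, he, he']
    · have hp' := VerticalWallPasses.transpose_of_not hf hb hne hp
      rw [deleteTopLeft_of_not_passes hp, directlyLeft_transpose, directlyAbove_transpose,
        directlyLeft_shiftUp hf.transpose hb.transpose ha hc,
        directlyAbove_shiftUp hf.transpose hb.transpose hp' ha hc, directlyLeft_transpose,
        directlyAbove_transpose]
      exact ⟨Iff.rfl, Iff.rfl⟩

/-! ### Relative positions of the rooms of a layout -/

/-- Room `a` is to the left of room `c`. -/
def LeftOf (f : Layout n) : Fin n → Fin n → Prop := Relation.TransGen f.DirectlyLeft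

/-- Room `a` is above room `c`. -/
def Above (f : Layout n) : Fin n → Fin n → Prop := Relation.TransGen f.DirectlyAbove

/-- One of the rooms is to the left of or above the other. -/
def Comparable (f : Layout n) (a c : Fin n) : Prop :=
  f.LeftOf a c ∨ f.LeftOf c a ∨ f.Above a c ∨ f.Above c a

theorem Comparable.symm {a c : Fin n} (h : f.Comparable a c) : f.Comparable c a := by
  unfold Comparable at *
  tauto

theorem leftOf_mirror : f.mirror.LeftOf = f.LeftOf :=
  congrArg Relation.TransGen (by ext; exact directlyLeft_mirror f _ _)

theorem above_mirror (a c : Fin n) : f.mirror.Above a c ↔ f.Above c a := by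
  have : f.mirror.DirectlyAbove = Function.swap f.DirectlyAbove := by
    ext; exact directlyAbove_mirror f _ _
  rw [Above, this, Relation.transGen_swap, Above]

theorem leftOf_transpose : f.transpose.LeftOf = f.Above :=
  congrArg Relation.TransGen (by ext; exact directlyLeft_transpose f _ _)

theorem above_transpose : f.transpose.Above = f.LeftOf :=
  congrArg Relation.TransGen (by ext; exact directlyAbove_transpose f _ _)

theorem comparable_mirror (a c : Fin n) : f.mirror.Comparable a c ↔ f.Comparable a c := by
  simp only [Comparable, leftOf_mirror, above_mirror]
  tauto

theorem comparable_transpose (a c : Fin n) : f.transpose.Comparable a c ↔ f.Comparable a c := by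
  simp only [Comparable, leftOf_transpose, above_transpose]
  tauto

theorem IsDissection.left_lt_of_leftOf (hf : f.IsDissection) {a c : Fin n} (h : f.LeftOf a c) :
    (f.room a).left < (f.room c).left := by
  have key : ∀ a c, f.DirectlyLeft a c → (f.room a).left < (f.room c).left := fun a c h =>
    (hf.width_pos a h.1).trans_eq h.2.2.1
  exact Relation.TransGen.trans_induction_on h (fun h => key _ _ h)
    fun _ _ h₁ h₂ => h₁.trans h₂

theorem IsDissection.top_lt_of_above (hf : f.IsDissection) {a c : Fin n} (h : f.Above a c) :
    (f.room c).top < (f.room a).top :=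
  neg_lt_neg_iff.1 (hf.transpose.left_lt_of_leftOf (leftOf_transpose ▸ h))

theorem LeftOf.mem {a c : Fin n} (h : f.LeftOf a c) : a ∈ f.rooms ∧ c ∈ f.rooms :=
  Relation.TransGen.trans_induction_on h (fun h => ⟨h.1, h.2.1⟩) fun _ _ h₁ h₂ => ⟨h₁.1, h₂.2⟩

theorem Above.mem {a c : Fin n} (h : f.Above a c) : a ∈ f.rooms ∧ c ∈ f.rooms :=
  LeftOf.mem (f := f.transpose) (leftOf_transpose ▸ h)

theorem IsTopLeft.not_leftOf (hf : f.IsDissection) (hb : f.IsTopLeft b) (a : Fin n) :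
    ¬ f.LeftOf a b := fun h => by
  linarith [hf.left_lt_of_leftOf h, hf.left_le a h.mem.1, hb.2.1]

theorem IsTopLeft.not_above (hf : f.IsDissection) (hb : f.IsTopLeft b) (a : Fin n) :
    ¬ f.Above a b := fun h => by
  linarith [hf.top_lt_of_above h, hf.top_le a h.mem.1, hb.2.2]

/-- The top-left room has no predecessor, so no chain between two other rooms passes through it. -/
theorem leftOf_deleteTopLeft (hf : f.IsDissection) (hb : f.IsTopLeft b) {a c : Fin n}
    (ha : a ≠ b) (hc : c ≠ b) : (f.deleteTopLeft b).LeftOf a c ↔ f.LeftOf a c := by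
  constructor
  · refine Relation.TransGen.mono (fun x y h => ?_) a c
    exact (directlyLeft_and_directlyAbove_deleteTopLeft hf hb (Finset.ne_of_mem_erase h.1)
      (Finset.ne_of_mem_erase h.2.1)).1.1 h
  · intro h
    induction h with
    | single h =>
      exact .single ((directlyLeft_and_directlyAbove_deleteTopLeft hf hb ha hc).1.2 h)
    | @tail x y h₁ h₂ ih =>
      have hne : x ≠ b := by rintro rfl; exact hb.not_leftOf hf _ h₁
      exact .tail (ih hne) ((directlyLeft_and_directlyAbove_deleteTopLeft hf hb hne hc).1.2 h₂)

theorem above_deleteTopLeft (hf : f.IsDissection) (hb : f.IsTopLeft b) {a c : Fin n}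
    (ha : a ≠ b) (hc : c ≠ b) : (f.deleteTopLeft b).Above a c ↔ f.Above a c := by
  constructor
  · refine Relation.TransGen.mono (fun x y h => ?_) a c
    exact (directlyLeft_and_directlyAbove_deleteTopLeft hf hb (Finset.ne_of_mem_erase h.1)
      (Finset.ne_of_mem_erase h.2.1)).2.1 h
  · intro h
    induction h with
    | single h =>
      exact .single ((directlyLeft_and_directlyAbove_deleteTopLeft hf hb ha hc).2.2 h)
    | @tail x y h₁ h₂ ih =>
      have hne : x ≠ b := by rintro rfl; exact hb.not_above hf _ h₁
      exact .tail (ih hne) ((directlyLeft_and_directlyAbove_deleteTopLeft hf hb hne hc).2.2 h₂)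

theorem comparable_deleteTopLeft (hf : f.IsDissection) (hb : f.IsTopLeft b) {a c : Fin n}
    (ha : a ≠ b) (hc : c ≠ b) : (f.deleteTopLeft b).Comparable a c ↔ f.Comparable a c := by
  simp only [Comparable, leftOf_deleteTopLeft hf hb ha hc, leftOf_deleteTopLeft hf hb hc ha,
    above_deleteTopLeft hf hb ha hc, above_deleteTopLeft hf hb hc ha]

/-! ### Any two rooms are comparable -/

/-- If `a` occupies the whole top side and `c` the whole bottom side, then `a` is above `c`, if
the rooms of all smaller dissections are comparable. -/
theorem IsDissection.above_of_top_of_bottom (hf : f.IsDissection)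
    (ih : ∀ g : Layout n, g.IsDissection → g.rooms.card < f.rooms.card →
      ∀ a ∈ g.rooms, ∀ c ∈ g.rooms, a ≠ c → g.Comparable a c)
    {a c : Fin n} (ha : f.IsTopLeft a) (har : (f.room a).right = f.box.right)
    (hc : f.mirror.IsTopLeft c) (hcr : (f.room c).right = f.box.right) (hac : a ≠ c) :
    f.Above a c := by
  have hc' := hc.2.1
  have hcb : (f.room c).bottom = f.box.bottom := neg_inj.1 hc.2.2
  have hcm : c ∈ f.rooms := hc.1
  simp only [Layout.mirror, Rectangle.mirror] at hc'
  have a1 := hf.width_pos a ha.1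
  have a2 := hf.height_pos a ha.1
  have c2 := hf.height_pos c hcm
  have hal := ha.2.1
  have hat := ha.2.2
  have below : ∀ i ∈ f.rooms, i ≠ a → (f.room i).top ≤ (f.room a).bottom := by
    intro i hi hia
    rcases hf.separated i hi a ha.1 hia with h | h | h | h <;>
      linarith [hf.width_pos i hi, hf.height_pos i hi, hf.left_le i hi, hf.right_le i hi,
        hf.top_le i hi]
  have direct : ∀ i ∈ f.rooms, (f.room a).bottom = (f.room i).top → f.DirectlyAbove a i := by
    refine fun i hi h => ⟨ha.1, hi, h, fun j hj h₁ h₂ => ?_⟩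
    rcases eq_or_ne j a with rfl | hja
    · linarith
    · linarith [below j hj hja]
  rcases eq_or_ne (f.room a).bottom (f.room c).top with he | hne
  · exact .single (direct c hcm he)
  have hlt := lt_of_le_of_ne (below c hcm hac.symm) hne.symm
  have hp : f.VerticalWallPasses a (f.room a).bottom := ⟨by linarith, by linarith, Or.inl har⟩
  have hdel := deleteTopLeft_of_passes hp
  have hf' := hf.deleteTopLeft ha
  have hcr' : c ∈ (f.deleteTopLeft a).rooms := Finset.mem_erase.2 ⟨hac.symm, hcm⟩
  -- The new top-left room `d` was attached to the bottom edge of `a`, so `a` is directly above `d`.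
  -- It remains to compare `d` with `c` in the smaller dissection; the position of `c` excludes
  -- every relation except `d` above `c`.
  obtain ⟨d, hd⟩ := hf'.exists_isTopLeft ⟨c, hcr'⟩
  obtain ⟨hda, hdm⟩ := Finset.mem_erase.1 hd.1
  have hdt := hd.2.2
  rw [hdel, shiftUp_box] at hdt
  have hd' : (f.room d).top = (f.room a).bottom := by
    rcases f.shiftUp_room_cases a d with h | h
    · exact h.1
    · linarith [below d hdm hda]
  have hdc : d ≠ c := by rintro rfl; exact hne hd'.symm
  have hcomp := (comparable_deleteTopLeft hf ha hda hac.symm).1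
    (ih _ hf' (Finset.card_erase_lt_of_mem ha.1) d hd.1 c hcr' hdc)
  refine .head (direct d hdm hd'.symm) ?_
  rcases hcomp with h | h | h | h
  · exact absurd (leftOf_mirror (f := f) ▸ h) (hc.not_leftOf hf.mirror d)
  -- Right sides increase along chains, but `c` already reaches the right side of the box.
  · have key : ∀ x y, f.DirectlyLeft x y → (f.room x).right < (f.room y).right := fun x y h =>
      h.2.2.1.trans_lt (hf.width_pos y h.2.1)
    have : (f.room c).right < (f.room d).right :=
      Relation.TransGen.trans_induction_on h (fun h => key _ _ h) fun _ _ h₁ h₂ => h₁.trans h₂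
    linarith [hf.right_le d hdm]
  · exact h
  · exact absurd ((above_mirror _ _).2 h) (hc.not_above hf.mirror d)

/-- Induction on the number of rooms. If some corner of the box belongs to a third room, deleting
that room does not affect comparability. Otherwise `a` and `c` occupy all four corners, so they
cover two opposite sides of the box. -/
theorem IsDissection.comparable (hf : f.IsDissection) {a c : Fin n} (ha : a ∈ f.rooms)
    (hc : c ∈ f.rooms) (hac : a ≠ c) : f.Comparable a c := by
  induction hk : f.rooms.card using Nat.strong_induction_on generalizing f a c with
  | _ k ih =>
  subst hk
  have ih' : ∀ g : Layout n, g.IsDissection → g.rooms.card < f.rooms.card →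
      ∀ a ∈ g.rooms, ∀ c ∈ g.rooms, a ≠ c → g.Comparable a c :=
    fun g hg hlt a ha c hc hac => ih _ hlt hg ha hc hac rfl
  have corner : ∀ g : Layout n, g.IsDissection → g.rooms = f.rooms →
      (∀ x y, g.Comparable x y ↔ f.Comparable x y) → f.Comparable a c ∨
        g.IsTopLeft a ∨ g.IsTopLeft c := by
    intro g hg hgf hcomp
    obtain ⟨b, hb⟩ := hg.exists_isTopLeft ⟨a, hgf ▸ ha⟩
    by_cases hba : a = b
    · exact Or.inr (Or.inl (hba ▸ hb))
    by_cases hbc : c = b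
    · exact Or.inr (Or.inr (hbc ▸ hb))
    · left
      rw [← hcomp, ← comparable_deleteTopLeft hg hb hba hbc]
      exact ih' _ (hg.deleteTopLeft hb) (hgf ▸ Finset.card_erase_lt_of_mem hb.1) _
        (Finset.mem_erase.2 ⟨hba, hgf ▸ ha⟩) _ (Finset.mem_erase.2 ⟨hbc, hgf ▸ hc⟩) hac
  by_contra hcon
  have hcon' : ¬ f.Comparable c a := fun h => hcon h.symm
  -- The four reflected layouts bring the top-left, bottom-left, top-right and bottom-right corners
  -- into top-left position.
  have tl := (corner f hf rfl fun _ _ => Iff.rfl).resolve_left hcon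
  have bl := (corner f.mirror hf.mirror rfl comparable_mirror).resolve_left hcon
  have tr := (corner f.transpose.mirror hf.transpose.mirror rfl fun x y => by
    rw [comparable_mirror, comparable_transpose]).resolve_left hcon
  have br := (corner f.mirror.transpose.mirror hf.mirror.transpose.mirror rfl fun x y => by
    rw [comparable_mirror, comparable_transpose, comparable_mirror]).resolve_left hcon
  have full : ∀ x ∈ f.rooms, ∀ y ∈ f.rooms, x ≠ y →
      ¬ ((f.room x).left = f.box.left ∧ (f.room x).right = f.box.right ∧
        (f.room x).bottom = f.box.bottom ∧ (f.room x).top = f.box.top) := by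
    rintro x hx y hy hxy ⟨h₁, h₂, h₃, h₄⟩
    rcases hf.separated x hx y hy hxy with h | h | h | h <;>
      linarith [hf.width_pos y hy, hf.height_pos y hy, hf.left_le y hy, hf.right_le y hy,
        hf.top_le y hy, hf.bottom_le y hy]
  have full₁ := full a ha c hc hac
  have full₂ := full c hc a ha hac.symm
  have vert : ∀ x y, x ≠ y → f.IsTopLeft x → (f.room x).right = f.box.right →
      f.mirror.IsTopLeft y → (f.room y).right = f.box.right → f.Above x y :=
    fun x y hxy h₁ h₂ h₃ h₄ => hf.above_of_top_of_bottom ih' h₁ h₂ h₃ h₄ hxy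
  have horiz : ∀ x y, x ≠ y → f.IsTopLeft x → (f.room x).bottom = f.box.bottom →
      f.transpose.mirror.IsTopLeft y → (f.room y).bottom = f.box.bottom → f.LeftOf x y := by
    intro x y hxy h₁ h₂ h₃ h₄
    rw [← above_transpose]
    exact hf.transpose.above_of_top_of_bottom ih' h₁.transpose (congrArg Neg.neg h₂) h₃
      (congrArg Neg.neg h₄) hxy
  have v₁ := vert a c hac
  have v₂ := vert c a hac.symm
  have z₁ := horiz a c hac
  have z₂ := horiz c a hac.symm
  clear corner full vert horiz ih ih'
  simp only [IsTopLeft, Layout.mirror, Layout.transpose, Rectangle.mirror, Rectangle.transpose,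
    neg_neg, neg_inj, ha, hc, true_and] at tl bl tr br v₁ v₂ z₁ z₂
  unfold Comparable at hcon
  rw [not_or, not_or, not_or] at hcon
  obtain ⟨c₁, c₂, c₃, c₄⟩ := hcon
  simp only [c₁, c₂, c₃, c₄, imp_false] at v₁ v₂ z₁ z₂
  -- A room at two diagonally opposite corners would fill the box. Otherwise each room has two
  -- adjacent corners, and one is above or left of the other.
  rcases tl with tl | tl <;> rcases bl with bl | bl <;> rcases tr with tr | tr <;>
    rcases br with br | br <;>
    first
      | exact full₁ ⟨tl.1, br.2, br.1, tl.2⟩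
      | exact full₂ ⟨tl.1, br.2, br.1, tl.2⟩
      | exact full₁ ⟨bl.1, tr.2, bl.2, tr.1⟩
      | exact full₂ ⟨bl.1, tr.2, bl.2, tr.1⟩
      | exact v₁ tl tr.2 bl br.2
      | exact v₂ tl tr.2 bl br.2
      | exact z₁ tl bl.2 tr br.1
      | exact z₂ tl bl.2 tr br.1

end Layout

namespace Layout

variable {n : ℕ} {f : Layout n} {b : Fin n}

/-! ### Deletion orders -/

theorem IsDissection.exists_isTopLeftDeletionOrder (hf : f.IsDissection) :
    ∃ l, f.IsTopLeftDeletionOrder l := by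
  induction hk : f.rooms.card generalizing f with
  | zero => exact ⟨[], Finset.card_eq_zero.1 hk⟩
  | succ k ih =>
    obtain ⟨b, hb⟩ := hf.exists_isTopLeft (Finset.card_pos.1 (hk ▸ k.succ_pos))
    obtain ⟨l, hl⟩ := ih (hf.deleteTopLeft hb) (by
      rw [show (f.deleteTopLeft b).rooms = f.rooms.erase b from rfl,
        Finset.card_erase_of_mem hb.1, hk, Nat.add_sub_cancel])
    exact ⟨b :: l, hb, hl⟩

theorem IsTopLeftDeletionOrder.mem_iff {l : List (Fin n)} (h : f.IsTopLeftDeletionOrder l)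
    (i : Fin n) : i ∈ l ↔ i ∈ f.rooms := by
  induction l generalizing f with
  | nil => simp [show f.rooms = ∅ from h]
  | cons b l ih =>
    have hb := h.1.1
    rw [List.mem_cons, ih h.2, show (f.deleteTopLeft b).rooms = f.rooms.erase b from rfl,
      Finset.mem_erase]
    by_cases hi : i = b <;> simp [hi, hb]

theorem IsTopLeftDeletionOrder.nodup {l : List (Fin n)} (h : f.IsTopLeftDeletionOrder l) :
    l.Nodup := by
  induction l generalizing f with
  | nil => exact List.nodup_nil
  | cons b l ih =>
    refine List.nodup_cons.2 ⟨fun hb => ?_, ih h.2⟩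
    exact Finset.ne_of_mem_erase ((h.2.mem_iff b).1 hb) rfl

/-- At each stage the removed room is minimal for both relations, and deletion does not change the
relations among the remaining rooms. -/
theorem IsTopLeftDeletionOrder.pairwise (hf : f.IsDissection) {l : List (Fin n)}
    (h : f.IsTopLeftDeletionOrder l) :
    l.Pairwise fun a c => ¬ f.LeftOf c a ∧ ¬ f.Above c a := by
  induction l generalizing f with
  | nil => exact .nil
  | cons b l ih =>
    obtain ⟨hb, hl⟩ := h
    refine List.pairwise_cons.2 ⟨fun c _ => ⟨hb.not_leftOf hf c, hb.not_above hf c⟩, ?_⟩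
    refine (ih (hf.deleteTopLeft hb) hl).imp_of_mem fun {a c} ha hc hac => ?_
    have ha' := Finset.ne_of_mem_erase ((hl.mem_iff a).1 ha)
    have hc' := Finset.ne_of_mem_erase ((hl.mem_iff c).1 hc)
    rwa [leftOf_deleteTopLeft hf hb hc' ha', above_deleteTopLeft hf hb hc' ha'] at hac

theorem deleteBottomLeft_eq (f : Layout n) (b : Fin n) :
    f.deleteBottomLeft b = (f.mirror.deleteTopLeft b).mirror := by
  have hp : f.mirror.VerticalWallPasses b (f.mirror.room b).bottom ↔
      f.VerticalWallPasses b (f.room b).top := by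
    simp only [VerticalWallPasses, mirror, Rectangle.mirror, neg_lt_neg_iff]
    grind
  have hr : ∀ i, (f.mirror.room i).top = (f.mirror.room b).bottom ∧
      (f.mirror.room b).left ≤ (f.mirror.room i).left ∧
      (f.mirror.room i).right ≤ (f.mirror.room b).right ↔
      (f.room i).bottom = (f.room b).top ∧ (f.room b).left ≤ (f.room i).left ∧
      (f.room i).right ≤ (f.room b).right := fun i => by simp [mirror, Rectangle.mirror]
  have hl : ∀ i, (f.mirror.room i).left = (f.mirror.room b).right ∧
      (f.mirror.room b).bottom ≤ (f.mirror.room i).bottom ∧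
      (f.mirror.room i).top ≤ (f.mirror.room b).top ↔
      (f.room i).left = (f.room b).right ∧ (f.room b).bottom ≤ (f.room i).bottom ∧
      (f.room i).top ≤ (f.room b).top := fun i => by
    simp only [mirror, Rectangle.mirror, neg_le_neg_iff]
    tauto
  by_cases h : f.VerticalWallPasses b (f.room b).top
  · have h' := hp.2 h
    simp only [deleteBottomLeft, deleteTopLeft, h, h', if_true, hr]
    rw [mirror, Layout.mk.injEq]
    refine ⟨(Rectangle.mirror_mirror _).symm, rfl, funext fun i => ?_⟩
    dsimp only
    split_ifs <;> simp [mirror, Rectangle.mirror]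
  · have h' := mt hp.1 h
    simp only [deleteBottomLeft, deleteTopLeft, h, h', if_false, hl]
    rw [mirror, Layout.mk.injEq]
    refine ⟨(Rectangle.mirror_mirror _).symm, rfl, funext fun i => ?_⟩
    dsimp only
    split_ifs <;> simp [mirror, Rectangle.mirror]

theorem isBottomLeftDeletionOrder_iff (l : List (Fin n)) :
    f.IsBottomLeftDeletionOrder l ↔ f.mirror.IsTopLeftDeletionOrder l := by
  induction l generalizing f with
  | nil => exact Iff.rfl
  | cons b l ih =>
    rw [IsBottomLeftDeletionOrder, IsTopLeftDeletionOrder, ih, deleteBottomLeft_eq,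
      mirror_mirror]
    refine and_congr_left fun _ => ?_
    simp [IsBottomLeft, IsTopLeft, mirror, Rectangle.mirror]

theorem isTopLeftDeletionOrder_iff (l : List (Fin n)) :
    f.IsTopLeftDeletionOrder l ↔ f.mirror.IsBottomLeftDeletionOrder l := by
  rw [isBottomLeftDeletionOrder_iff, mirror_mirror]

theorem IsDissection.exists_perm (hf : f.IsDissection) (hu : f.rooms = Finset.univ) :
    ∃ t : Equiv.Perm (Fin n), f.IsTopLeftDeletionOrder (List.ofFn t) := by
  obtain ⟨l, hl⟩ := hf.exists_isTopLeftDeletionOrder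
  have hlen : l.length = n := by
    rw [← List.toFinset_card_of_nodup hl.nodup]
    have : l.toFinset = Finset.univ := by ext i; simp [hl.mem_iff, hu]
    simp [this]
  refine ⟨Equiv.ofBijective (fun i => l.get (i.cast hlen.symm)) (Finite.injective_iff_bijective.1
    ((List.nodup_iff_injective_get.1 hl.nodup).comp (Fin.cast_injective _))), ?_⟩
  convert hl
  exact List.ext_get (by simp [hlen]) (by simp)

/-- The top-left deletion order extends both relations between the rooms. -/
theorem IsTopLeftDeletionOrder.symm_lt_symm (hf : f.IsDissection) {t : Equiv.Perm (Fin n)}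
    (ht : f.IsTopLeftDeletionOrder (List.ofFn t)) {a c : Fin n} :
    (f.LeftOf a c → t.symm a < t.symm c) ∧ (f.Above a c → t.symm a < t.symm c) := by
  have hp := List.pairwise_ofFn.1 (ht.pairwise hf)
  have key : ¬ t.symm a < t.symm c → a = c ∨ (¬ f.LeftOf a c ∧ ¬ f.Above a c) := by
    intro h
    rcases (not_lt.1 h).eq_or_lt with h | h
    · exact Or.inl (t.symm.injective h.symm)
    · simpa using Or.inr (hp h)
  constructor <;> intro h <;> by_contra hn <;> rcases key hn with rfl | h'
  · exact lt_irrefl _ (hf.left_lt_of_leftOf h)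
  · exact h'.1 h
  · exact lt_irrefl _ (hf.top_lt_of_above h)
  · exact h'.2 h

/-- The relative positions of the rooms can be read off from the two deletion orders. -/
theorem IsDissection.leftOf_and_above_iff (hf : f.IsDissection) (hu : f.rooms = Finset.univ)
    {t b : Equiv.Perm (Fin n)} (ht : f.IsTopLeftDeletionOrder (List.ofFn t))
    (hb : f.IsBottomLeftDeletionOrder (List.ofFn b)) (a c : Fin n) :
    (f.LeftOf a c ↔ t.symm a < t.symm c ∧ b.symm a < b.symm c) ∧
    (f.Above a c ↔ t.symm a < t.symm c ∧ b.symm c < b.symm a) := by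
  have key : ∀ a c, (f.LeftOf a c → t.symm a < t.symm c ∧ b.symm a < b.symm c) ∧
      (f.Above a c → t.symm a < t.symm c ∧ b.symm c < b.symm a) := by
    intro a c
    have hb' := (isBottomLeftDeletionOrder_iff _).1 hb
    have h₁ := IsTopLeftDeletionOrder.symm_lt_symm hf ht (a := a) (c := c)
    have h₂ := IsTopLeftDeletionOrder.symm_lt_symm hf.mirror hb' (a := a) (c := c)
    have h₃ := IsTopLeftDeletionOrder.symm_lt_symm hf.mirror hb' (a := c) (c := a)
    rw [leftOf_mirror] at h₂
    rw [above_mirror] at h₃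
    exact ⟨fun h => ⟨h₁.1 h, h₂.1 h⟩, fun h => ⟨h₁.2 h, h₃.2 h⟩⟩
  have hac := key a c
  have hca := key c a
  by_cases h : a = c
  · subst h
    simp only [lt_irrefl, and_false, imp_false, iff_false] at hac ⊢
    exact hac
  -- The four relations imply mutually exclusive order patterns, and at least one of them holds;
  -- hence the implications in `key` reverse.
  · have := hf.comparable (hu ▸ Finset.mem_univ a) (hu ▸ Finset.mem_univ c) h
    unfold Comparable at this
    grind

end Layout

/-! ### Equivalence classes of floorplans and their permutations. -/

namespace MosaicFloorplan

variable {n : ℕ}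

theorem isDissection (f : MosaicFloorplan n) : f.toLayout.IsDissection := by
  have sub : ∀ i x y, (f.room i).left ≤ x → x ≤ (f.room i).right → (f.room i).bottom ≤ y →
      y ≤ (f.room i).top → (x, y) ∈ f.box.region := fun i x y h₁ h₂ h₃ h₄ => by
    rw [← f.cover]
    exact Set.mem_iUnion.2 ⟨i, ⟨h₁, h₂⟩, h₃, h₄⟩
  have bl := fun i => sub i _ _ le_rfl (f.room_nondegenerate i).1.le le_rfl
    (f.room_nondegenerate i).2.le
  have tr := fun i => sub i _ _ (f.room_nondegenerate i).1.le le_rfl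
    (f.room_nondegenerate i).2.le le_rfl
  refine ⟨fun i _ => (f.room_nondegenerate i).1, fun i _ => (f.room_nondegenerate i).2,
    fun i _ => (bl i).1.1, fun i _ => (tr i).1.2, fun i _ => (bl i).2.1, fun i _ => (tr i).2.2,
    ?_, ?_, ?_⟩
  · intro i _ j _ hij
    by_contra! h
    obtain ⟨h₁, h₂, h₃, h₄⟩ := h
    simp only [toLayout] at h₁ h₂ h₃ h₄
    have hi := f.room_nondegenerate i
    have hj := f.room_nondegenerate j
    obtain ⟨x, hx, hx'⟩ := exists_between (max_lt (lt_min hi.1 h₂) (lt_min h₁ hj.1))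
    obtain ⟨y, hy, hy'⟩ := exists_between (max_lt (lt_min hi.2 h₄) (lt_min h₃ hj.2))
    rw [max_lt_iff] at hx hy
    rw [lt_min_iff] at hx' hy'
    exact (Set.disjoint_left.1 (f.disjoint i j hij) : ∀ ⦃p⦄, _)
      (show (x, y) ∈ (f.room i).inner from ⟨⟨hx.1, hx'.1⟩, hy.1, hy'.1⟩)
      ⟨⟨hx.2, hx'.2⟩, hy.2, hy'.2⟩
  · intro _ x y h₁ h₂ h₃ h₄
    have h : (x, y) ∈ f.box.region := ⟨⟨h₁, h₂⟩, h₃, h₄⟩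
    rw [← f.cover] at h
    obtain ⟨i, hi⟩ := Set.mem_iUnion.1 h
    exact ⟨i, Finset.mem_univ i, hi⟩
  · intro x y a _ b _ c _ d _ h1 h2 h3 h4 h5 h6 h7 h8
    exact f.no_cross ⟨x, y, a, b, c, d, ⟨h1, h2⟩, ⟨h3, h4⟩, ⟨h5, h6⟩, h7, h8⟩

/-- An open interval misses a nondegenerate closed interval only by lying on one side of it. This
turns the condition that a segment avoids the interior of a room into inequalities. -/
theorem forall_Icc_not_mem_Ioo_iff {p q r s u v : ℝ} (huv : u < v) (hpr : p < r) :
    (∀ y ∈ Set.Icc (min p q) (max r s), y ∉ Set.Ioo u v) ↔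
      (v ≤ p ∧ v ≤ q) ∨ (r ≤ u ∧ s ≤ u) := by
  rw [← le_min_iff, ← max_le_iff]
  have hm : min p q < max r s := (min_le_left _ _).trans_lt (hpr.trans_le (le_max_left _ _))
  constructor
  · intro h
    by_contra! hcon
    obtain ⟨y, hy, hy'⟩ := exists_between (max_lt (lt_min huv hcon.2) (lt_min hcon.1 hm))
    rw [max_lt_iff] at hy
    rw [lt_min_iff] at hy'
    exact h y ⟨hy.2.le, hy'.2.le⟩ ⟨hy.1, hy'.1⟩
  · rintro (h | h) y hy hy'
    · exact absurd (hy.1.trans_lt hy'.2) (not_lt.2 h)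
    · exact absurd (hy'.1.trans_le hy.2) (not_lt.2 h)

theorem directlyLeftOf_iff (f : MosaicFloorplan n) (a c : Fin n) :
    f.DirectlyLeftOf a c ↔ f.toLayout.DirectlyLeft a c := by
  have key := fun i => forall_Icc_not_mem_Ioo_iff (f.room_nondegenerate i).2
    (f.room_nondegenerate a).2 (q := (f.room c).bottom) (s := (f.room c).top)
  simp only [DirectlyLeftOf, Layout.DirectlyLeft, toLayout, Finset.mem_univ, true_and,
    true_implies, ← key, Rectangle.inner, Set.mem_prod, Set.mem_Ioo, not_and]
  grind

theorem directlyAbove_iff (f : MosaicFloorplan n) (a c : Fin n) :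
    f.DirectlyAbove a c ↔ f.toLayout.DirectlyAbove a c := by
  have key := fun i => forall_Icc_not_mem_Ioo_iff (f.room_nondegenerate i).1
    (f.room_nondegenerate a).1 (q := (f.room c).left) (s := (f.room c).right)
  simp only [DirectlyAbove, Layout.DirectlyAbove, toLayout, Finset.mem_univ, true_and,
    true_implies, ← key, Rectangle.inner, Set.mem_prod, Set.mem_Ioo, not_and]
  grind

theorem leftOf_eq (f : MosaicFloorplan n) : f.LeftOf = f.toLayout.LeftOf :=
  congrArg Relation.TransGen (by ext; exact f.directlyLeftOf_iff _ _)

theorem above_eq (f : MosaicFloorplan n) : f.Above = f.toLayout.Above :=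
  congrArg Relation.TransGen (by ext; exact f.directlyAbove_iff _ _)

theorem leftOf_and_above_iff (f : MosaicFloorplan n)
    {t b : Equiv.Perm (Fin n)} (ht : f.toLayout.IsTopLeftDeletionOrder (List.ofFn t))
    (hb : f.toLayout.IsBottomLeftDeletionOrder (List.ofFn b)) (a c : Fin n) :
    (f.LeftOf a c ↔ t.symm a < t.symm c ∧ b.symm a < b.symm c) ∧
    (f.Above a c ↔ t.symm a < t.symm c ∧ b.symm c < b.symm a) := by
  rw [leftOf_eq, above_eq]
  exact f.isDissection.leftOf_and_above_iff rfl ht hb a c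

theorem exists_deletionOrders (f : MosaicFloorplan n) :
    ∃ t b : Equiv.Perm (Fin n), f.toLayout.IsTopLeftDeletionOrder (List.ofFn t) ∧
      f.toLayout.IsBottomLeftDeletionOrder (List.ofFn b) := by
  obtain ⟨t, ht⟩ := f.isDissection.exists_perm rfl
  obtain ⟨b, hb⟩ := f.isDissection.mirror.exists_perm rfl
  exact ⟨t, b, ht, (Layout.isBottomLeftDeletionOrder_iff _).2 hb⟩

/-- Permutations that compare all pairs in the same way are equal. -/
theorem _root_.Equiv.Perm.eq_of_lt_iff_lt {σ τ : Equiv.Perm (Fin n)}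
    (h : ∀ a c, σ a < σ c ↔ τ a < τ c) : σ = τ := by
  have hm : StrictMono (σ.symm.trans τ) := fun a c hac => by
    simpa [← h] using hac
  -- The identity is the only order automorphism of `Fin n`.
  have := Subsingleton.elim (hm.orderIsoOfSurjective _ (σ.symm.trans τ).surjective)
    (OrderIso.refl (Fin n))
  ext i
  have h' := DFunLike.congr_fun this (σ i)
  simp at h'
  rw [h']

theorem CorrespondsTo.equivalent {f g : MosaicFloorplan n} {π : Equiv.Perm (Fin n)}
    (hf : f.CorrespondsTo π) (hg : g.CorrespondsTo π) : f.Equivalent g := by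
  obtain ⟨t, b, ht, hb, h⟩ := hf
  obtain ⟨t', b', ht', hb', h'⟩ := hg
  have e₁ : ∀ x, b.symm x = π.symm (t.symm x) := fun x => by
    rw [Equiv.eq_symm_apply, h, Equiv.apply_symm_apply]
  have e₂ : ∀ x, b'.symm x = π.symm (t'.symm x) := fun x => by
    rw [Equiv.eq_symm_apply, h', Equiv.apply_symm_apply]
  -- Match the rooms that carry the same top-left label.
  refine ⟨t.symm.trans t', fun a c => ?_⟩
  rw [(f.leftOf_and_above_iff ht hb a c).1, (f.leftOf_and_above_iff ht hb a c).2,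
    (g.leftOf_and_above_iff ht' hb' _ _).1, (g.leftOf_and_above_iff ht' hb' _ _).2]
  simp [e₁, e₂]

/-- The relations determine both deletion orders: one room precedes another in the top-left order
exactly when it is left of or above it, and similarly for the bottom-left order with "below". -/
theorem Equivalent.correspondsTo {f g : MosaicFloorplan n} {π : Equiv.Perm (Fin n)}
    (hgf : g.Equivalent f) (hf : f.CorrespondsTo π) : g.CorrespondsTo π := by
  obtain ⟨t, b, ht, hb, h⟩ := hf
  obtain ⟨e, he⟩ := hgf
  obtain ⟨t', b', ht', hb'⟩ := g.exists_deletionOrders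
  have key : ∀ a c,
      (t'.symm a < t'.symm c ↔ t.symm (e a) < t.symm (e c)) ∧
      (b'.symm a < b'.symm c ↔ b.symm (e a) < b.symm (e c)) := by
    intro a c
    have h₁ := g.leftOf_and_above_iff ht' hb' a c
    have h₂ := g.leftOf_and_above_iff ht' hb' c a
    have h₃ := f.leftOf_and_above_iff ht hb (e a) (e c)
    have h₄ := f.leftOf_and_above_iff ht hb (e c) (e a)
    have h₅ := he a c
    have h₆ := he c a
    by_cases hac : a = c
    · simp [hac]
    have n₁ : t'.symm a ≠ t'.symm c := by simpa
    have n₂ : b'.symm a ≠ b'.symm c := by simpa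
    have n₃ : t.symm (e a) ≠ t.symm (e c) := by simpa
    have n₄ : b.symm (e a) ≠ b.symm (e c) := by simpa
    grind
  have k₁ : t'.symm = e.trans t.symm := Equiv.Perm.eq_of_lt_iff_lt fun a c => (key a c).1
  have k₂ : b'.symm = e.trans b.symm := Equiv.Perm.eq_of_lt_iff_lt fun a c => (key a c).2
  refine ⟨t', b', ht', hb', fun i => ?_⟩
  have : b i = e (b' i) := by
    have := DFunLike.congr_fun k₂ (b' i)
    exact ((Equiv.symm_apply_eq b).1 (by simpa using this.symm)).symm
  rw [h, this, k₁, Equiv.trans_apply]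

/-- The reflection exchanges the two deletion orders. -/
theorem CorrespondsTo.mirror {f : MosaicFloorplan n} {π : Equiv.Perm (Fin n)}
    (hf : f.CorrespondsTo π) : f.mirror.CorrespondsTo π⁻¹ := by
  obtain ⟨t, b, ht, hb, h⟩ := hf
  refine ⟨b, t, (Layout.isBottomLeftDeletionOrder_iff _).1 hb,
    (Layout.isTopLeftDeletionOrder_iff _).1 ht, fun i => ?_⟩
  rw [Equiv.Perm.inv_eq_iff_eq, h]
  simp

end MosaicFloorplan

/-! ### The floorplan of a permutation -/

namespace PermFloorplan

variable {n : ℕ}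

/-- The left side of room `k` in the floorplan of a permutation: the least coordinate right of all
diagonal cells `j < k` with `p j < p k`. -/
def lower (p : Equiv.Perm (Fin n)) (k : Fin n) : ℕ :=
  (Finset.univ.filter fun j => j < k ∧ p j < p k).sup fun j => (j : ℕ) + 1

/-- The right side of room `k` in the floorplan of a permutation: the greatest coordinate left of
all diagonal cells `j > k` with `p k < p j`. -/
def upper (p : Equiv.Perm (Fin n)) (k : Fin n) : ℕ :=
  n - (Finset.univ.filter fun j => k < j ∧ p k < p j).sup fun j => n - (j : ℕ)

theorem lower_le_iff (p : Equiv.Perm (Fin n)) (k : Fin n) (x : ℕ) :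
    lower p k ≤ x ↔ ∀ j, j < k → p j < p k → (j : ℕ) < x := by
  simp [lower]

/-- The minimum in `upper` is written as `n` minus a supremum, so that it is `n` when there is no
such `j`. -/
theorem le_upper_iff (p : Equiv.Perm (Fin n)) (k : Fin n) (x : ℕ) :
    x ≤ upper p k ↔ x ≤ n ∧ ∀ j, k < j → p k < p j → x ≤ (j : ℕ) := by
  have hS : ((Finset.univ.filter fun j => k < j ∧ p k < p j).sup fun j => n - (j : ℕ)) ≤ n :=
    Finset.sup_le fun j _ => Nat.sub_le _ _
  have : x ≤ upper p k ↔ x ≤ n ∧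
      ((Finset.univ.filter fun j => k < j ∧ p k < p j).sup fun j => n - (j : ℕ)) ≤ n - x := by
    unfold upper
    omega
  rw [this]
  refine and_congr_right fun hx => ?_
  simp only [Finset.sup_le_iff, Finset.mem_filter, Finset.mem_univ, true_and, and_imp]
  refine forall_congr' fun j => forall_congr' fun _ => forall_congr' fun _ => ?_
  omega

theorem lower_le (p : Equiv.Perm (Fin n)) (k : Fin n) : lower p k ≤ k :=
  (lower_le_iff p k k).2 fun _ h _ => h

theorem lt_upper (p : Equiv.Perm (Fin n)) (k : Fin n) : (k : ℕ) < upper p k :=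
  (le_upper_iff p k (k + 1)).2 ⟨k.2, fun _ h _ => h⟩

theorem upper_le (p : Equiv.Perm (Fin n)) (k : Fin n) : upper p k ≤ n :=
  ((le_upper_iff p k _).1 le_rfl).1

/-- Otherwise the index `l = lower p k` lies strictly between `j` and `k`. The definition of `lower`
excludes `p l < p k` and that of `upper` excludes `p j < p l`, which contradicts `p j < p k`. -/
theorem upper_le_lower (p : Equiv.Perm (Fin n)) {j k : Fin n} (hjk : j < k) (hp : p j < p k) :
    upper p j ≤ lower p k := by
  by_contra! h
  have h₁ := (lower_le_iff p k _).1 le_rfl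
  have h₂ := ((le_upper_iff p j (lower p k + 1)).1 h).2
  have h₃ := h₁ j hjk hp
  have h₄ := h₂ k hjk hp
  have h₅ := h₁ ⟨lower p k, by omega⟩ h₄
  have h₆ := h₂ ⟨lower p k, by omega⟩ h₃
  have h₇ : p j ≠ p ⟨lower p k, by omega⟩ := by
    simp [Fin.ext_iff, h₃.ne]
  grind

theorem exists_of_lower_eq (p : Equiv.Perm (Fin n)) {k y : Fin n}
    (h : lower p k = (y : ℕ) + 1) : y < k ∧ p y < p k := by
  have h₁ := (lower_le_iff p k _).1 h.le
  have h₂ := mt (lower_le_iff p k y).2 (by omega)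
  push Not at h₂
  obtain ⟨j, hj, hj', hyj⟩ := h₂
  have := h₁ j hj hj'
  obtain rfl : j = y := by ext; omega
  exact ⟨hj, hj'⟩

theorem exists_of_upper_eq (p : Equiv.Perm (Fin n)) {k x : Fin n}
    (h : upper p k = x) : k < x ∧ p k < p x := by
  have h₁ := ((le_upper_iff p k _).1 h.ge).2
  have h₂ := mt (le_upper_iff p k (x + 1)).2 (by omega)
  push Not at h₂
  obtain ⟨j, hj, hj', hxj⟩ := h₂ x.2
  have := h₁ j hj hj'
  obtain rfl : j = x := by ext; omega
  exact ⟨hj, hj'⟩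

/-- The permutation with the reversed order of values. -/
def rev (p : Equiv.Perm (Fin n)) : Equiv.Perm (Fin n) := p.trans Fin.revPerm

@[simp] theorem rev_lt_rev_iff (p : Equiv.Perm (Fin n)) (a c : Fin n) :
    rev p a < rev p c ↔ p c < p a := by
  simp [rev]

@[simp] theorem rev_rev (p : Equiv.Perm (Fin n)) : rev (rev p) = p := by
  ext; simp [rev]

/-- Room `k` of the floorplan of a permutation; it contains the `k`-th cell of the diagonal. -/
def room (p : Equiv.Perm (Fin n)) (k : Fin n) : Rectangle :=
  ⟨lower p k, upper p k, -upper (rev p) k, -lower (rev p) k⟩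

/-- The unit cell in column `x` and row `y`, on or below the diagonal, lies in the room `k` that
minimises `p` on `[x, y]`. Cells above the diagonal follow by passing to `rev p`. -/
theorem exists_cell_of_le (p : Equiv.Perm (Fin n)) {x y : Fin n} (hxy : x ≤ y) :
    ∃ k, (lower p k ≤ x ∧ (x : ℕ) < upper p k) ∧
      lower (rev p) k ≤ y ∧ (y : ℕ) < upper (rev p) k := by
  obtain ⟨k, hk, hmin⟩ := (Finset.Icc x y).exists_min_image p ⟨x, Finset.left_mem_Icc.2 hxy⟩
  simp only [Finset.mem_Icc] at hk hmin
  refine ⟨k, ⟨(lower_le_iff _ _ _).2 fun j h₁ h₂ => ?_, (lt_upper p k).trans_le' hk.1⟩,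
    (lower_le (rev p) k).trans hk.2, (le_upper_iff _ _ _).2 ⟨y.2, fun j h₁ h₂ => ?_⟩⟩
  · by_contra h
    exact absurd (hmin j ⟨not_lt.1 h, h₁.le.trans hk.2⟩) (not_le.2 h₂)
  · rw [rev_lt_rev_iff] at h₂
    by_contra h
    exact absurd (hmin j ⟨hk.1.trans h₁.le, by omega⟩) (not_le.2 h₂)

theorem exists_cell (p : Equiv.Perm (Fin n)) (x y : Fin n) :
    ∃ k, (lower p k ≤ x ∧ (x : ℕ) < upper p k) ∧
      lower (rev p) k ≤ y ∧ (y : ℕ) < upper (rev p) k := by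
  rcases le_total x y with h | h
  · exact exists_cell_of_le p h
  · obtain ⟨k, h₁, h₂⟩ := exists_cell_of_le (rev p) h
    rw [rev_rev] at h₂
    exact ⟨k, h₂, h₁⟩

theorem exists_fin_of_mem_Icc (hn : 0 < n) {x : ℝ} (h₀ : 0 ≤ x) (h₁ : x ≤ n) :
    ∃ k : Fin n, (k : ℝ) ≤ x ∧ x ≤ (k : ℝ) + 1 := by
  rcases h₁.eq_or_lt with rfl | h
  · refine ⟨⟨n - 1, by omega⟩, ?_, ?_⟩ <;> push_cast [Nat.cast_sub hn] <;> linarith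
  · exact ⟨⟨⌊x⌋₊, (Nat.floor_lt h₀).2 h⟩, Nat.floor_le h₀, (Nat.lt_floor_add_one x).le⟩

theorem right_le_left_or_top_le_bottom (p : Equiv.Perm (Fin n)) {j k : Fin n} (h : j < k) :
    (room p j).right ≤ (room p k).left ∨ (room p k).top ≤ (room p j).bottom := by
  rcases lt_or_gt_of_ne (p.injective.ne h.ne) with hp | hp
  · exact Or.inl (Nat.cast_le.2 (upper_le_lower p h hp))
  · refine Or.inr (neg_le_neg ?_)
    exact Nat.cast_le.2 (upper_le_lower (rev p) h ((rev_lt_rev_iff p j k).2 hp))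

/-- The floorplan of a permutation `p`: the rooms are arranged along the diagonal of a square from
the top-left to the bottom-right corner, and for `j < k` room `j` is to the left of or above room
`k` according to whether `p j < p k`. -/
def floorplan (hn : 0 < n) (p : Equiv.Perm (Fin n)) : MosaicFloorplan n where
  box := ⟨0, n, -n, 0⟩
  room := room p
  box_nondegenerate := by simp [Rectangle.Nondegenerate, hn]
  room_nondegenerate k := by
    refine ⟨?_, neg_lt_neg ?_⟩ <;> exact Nat.cast_lt.2 ((lower_le _ k).trans_lt (lt_upper _ k))
  disjoint := by
    have key : ∀ j k, j < k → Disjoint (room p j).inner (room p k).inner := by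
      intro j k h
      rw [Set.disjoint_left]
      rintro ⟨x, y⟩ ⟨hx, hy⟩ ⟨hx', hy'⟩
      rcases right_le_left_or_top_le_bottom p h with h | h
      · exact absurd (hx.2.trans_le (h.trans hx'.1.le)) (lt_irrefl _)
      · exact absurd (hy'.2.trans_le (h.trans hy.1.le)) (lt_irrefl _)
    intro j k h
    rcases lt_or_gt_of_ne h with h | h
    · exact key j k h
    · exact (key k j h).symm
  cover := by
    ext ⟨x, y⟩
    simp only [Set.mem_iUnion, Rectangle.region, Set.mem_prod, Set.mem_Icc, room]
    constructor
    · rintro ⟨k, ⟨h₁, h₂⟩, h₃, h₄⟩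
      have u₁ : (upper p k : ℝ) ≤ n := by exact_mod_cast upper_le p k
      have u₂ : (upper (rev p) k : ℝ) ≤ n := by exact_mod_cast upper_le (rev p) k
      have l₁ : (0 : ℝ) ≤ lower p k := Nat.cast_nonneg _
      have l₂ : (0 : ℝ) ≤ lower (rev p) k := Nat.cast_nonneg _
      exact ⟨⟨by linarith, by linarith⟩, by linarith, by linarith⟩
    · rintro ⟨⟨h₁, h₂⟩, h₃, h₄⟩
      obtain ⟨i, hi, hi'⟩ := exists_fin_of_mem_Icc hn h₁ h₂
      obtain ⟨j, hj, hj'⟩ := exists_fin_of_mem_Icc hn (x := -y) (by linarith) (by linarith)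
      obtain ⟨k, ⟨k₁, k₂⟩, k₃, k₄⟩ := exists_cell p i j
      have k₁ : (lower p k : ℝ) ≤ i := by exact_mod_cast k₁
      have k₂ : (i : ℝ) + 1 ≤ upper p k := by exact_mod_cast k₂
      have k₃ : (lower (rev p) k : ℝ) ≤ j := by exact_mod_cast k₃
      have k₄ : (j : ℝ) + 1 ≤ upper (rev p) k := by exact_mod_cast k₄
      exact ⟨k, ⟨by linarith, by linarith⟩, by linarith, by linarith⟩
  no_cross := by
    -- The upper-right room `b` and the lower-left room `c` already conflict: since each contains
    -- its diagonal cell, `b` puts the point strictly below the diagonal and `c` strictly above.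
    rintro ⟨x, y, a, b, c, d, -, ⟨rfl, rfl⟩, ⟨hc, hc'⟩, -⟩
    simp only [room, neg_inj, Nat.cast_inj] at hc hc'
    have h₁ := lower_le p b
    have h₂ := lt_upper (rev p) b
    have h₃ := lower_le (rev p) c
    have h₄ := lt_upper p c
    omega

/-- Through this symmetry statements about "above" for `p` become statements about "left of" for
`rev p`. -/
theorem transpose_toLayout_floorplan (hn : 0 < n) (p : Equiv.Perm (Fin n)) :
    (floorplan hn p).toLayout.transpose = (floorplan hn (rev p)).toLayout := by
  simp [Layout.transpose, MosaicFloorplan.toLayout, floorplan, Rectangle.transpose, room,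
    funext_iff]

/-- Let `x` be the common abscissa. Values of `p` strictly between positions `k` and `x` are below
`p k`, and those from `x` up to before `m` are above `p m`. A room `i` straddling the abscissa has
`i < k` and a value above both, so it lies above both rooms, or `m < i` and a value below both, so
it lies below both. -/
theorem directlyLeft_floorplan (hn : 0 < n) (p : Equiv.Perm (Fin n)) {k m : Fin n}
    (h : upper p k = lower p m) : (floorplan hn p).toLayout.DirectlyLeft k m := by
  have hk := lt_upper p k
  have hm := lower_le p m
  obtain ⟨x, hx⟩ : ∃ x : Fin n, upper p k = x := ⟨⟨upper p k, by omega⟩, rfl⟩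
  obtain ⟨w, hw⟩ : ∃ w : Fin n, upper p k = (w : ℕ) + 1 :=
    ⟨⟨upper p k - 1, by omega⟩, by simp only; omega⟩
  have k₁ := (exists_of_upper_eq p hx).2
  have m₁ := (exists_of_lower_eq p (h ▸ hw)).2
  have k₂ : ∀ j, k < j → j < x → p j < p k := by
    intro j h₁ h₂
    by_contra hcon
    have h₃ : p k < p j := lt_of_le_of_ne (not_lt.1 hcon) (p.injective.ne h₁.ne)
    have := ((le_upper_iff p k x).1 hx.ge).2 j h₁ h₃
    omega
  have m₂ : ∀ j, x ≤ j → j < m → p m < p j := by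
    intro j h₁ h₂
    by_contra hcon
    have h₃ : p j < p m := lt_of_le_of_ne (not_lt.1 hcon) (p.injective.ne h₂.ne)
    have := (lower_le_iff p m x).1 (h ▸ hx.le) j h₂ h₃
    omega
  have hwk : p w ≤ p k := by
    rcases eq_or_ne w k with rfl | hne
    · exact le_rfl
    · exact (k₂ w (by omega) (by omega)).le
  have hmx : p m ≤ p x := by
    rcases eq_or_ne x m with rfl | hne
    · exact le_rfl
    · exact (m₂ x le_rfl (by omega)).le
  have sep : ∀ i j, i < j → p j < p i → (room p j).top ≤ (room p i).bottom := fun i j h₁ h₂ =>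
    neg_le_neg (Nat.cast_le.2 (upper_le_lower (rev p) h₁ ((rev_lt_rev_iff p i j).2 h₂)))
  refine ⟨Finset.mem_univ _, Finset.mem_univ _, congrArg Nat.cast h, fun i _ hl hr => ?_⟩
  replace hl : lower p i ≤ w := by
    have : lower p i < upper p k := Nat.cast_lt.1 hl
    omega
  replace hr : (x : ℕ) + 1 ≤ upper p i := by
    have : upper p k < upper p i := Nat.cast_lt.1 hr
    omega
  rcases lt_or_ge i x with hix | hix
  · have hxi : p x < p i := by
      by_contra hcon
      have h₃ : p i < p x := lt_of_le_of_ne (not_lt.1 hcon) (p.injective.ne hix.ne)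
      have := ((le_upper_iff p i _).1 hr).2 x hix h₃
      omega
    have hik : i < k := by
      by_contra hcon
      rcases (not_lt.1 hcon).eq_or_lt with rfl | hlt
      · exact (k₁.trans hxi).false
      · exact ((k₂ i hlt hix).trans (k₁.trans hxi)).false
    exact Or.inr ⟨sep _ _ hik (k₁.trans hxi), sep _ _ (by omega) (hmx.trans_lt hxi)⟩
  · have hiw : p i < p w := by
      by_contra hcon
      have hlt : w < i := by omega
      have h₃ : p w < p i := lt_of_le_of_ne (not_lt.1 hcon) (p.injective.ne hlt.ne)
      exact absurd ((lower_le_iff p i _).1 hl w hlt h₃) (lt_irrefl _)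
    have hmi : m < i := by
      by_contra hcon
      rcases (not_lt.1 hcon).eq_or_lt with rfl | hlt
      · exact (m₁.trans hiw).false
      · exact ((m₂ i hix hlt).trans (hiw.trans m₁)).false
    exact Or.inl ⟨sep _ _ (by omega) (hiw.trans_le hwk), sep _ _ hmi (hiw.trans m₁)⟩

/-- There are no `k < z < z + 1 < m` with `p (z + 1) < p k < p m < p z`. -/
def AvoidsAscent (p : Equiv.Perm (Fin n)) : Prop :=
  ∀ k m z z' : Fin n, k < z → (z' : ℕ) = z + 1 → z' < m → p k < p m → p z' < p k → ¬ p m < p z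

/-- Inversion turns the consecutive values of the Baxter condition into consecutive positions. One
half of the condition gives this statement, the other half the one for the reversed permutation. -/
theorem avoidsAscent_symm {π : Equiv.Perm (Fin n)} (hπ : IsBaxter π) :
    AvoidsAscent π.symm := by
  intro k m z z' hkz hz hm hkm hk hmz
  refine (hπ _ _ _ _ hk hkm hmz).2 ?_
  simp only [Equiv.apply_symm_apply]
  omega

theorem avoidsAscent_rev_symm {π : Equiv.Perm (Fin n)} (hπ : IsBaxter π) :
    AvoidsAscent (rev π.symm) := by
  intro k m z z' hkz hz hm hkm hk hmz
  rw [rev_lt_rev_iff] at hkm hk hmz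
  refine (hπ _ _ _ _ hmz hkm hk).1 ?_
  simp only [Equiv.apply_symm_apply]
  omega

/-- Induction on `m - k`: an intermediate position with intermediate value splits the pair. Without
one, the two rooms share a wall. -/
theorem leftOf_floorplan (hn : 0 < n) {p : Equiv.Perm (Fin n)} (h : AvoidsAscent p) {k m : Fin n}
    (hkm : k < m) (hp : p k < p m) : (floorplan hn p).toLayout.LeftOf k m := by
  induction hd : (m : ℕ) - k using Nat.strong_induction_on generalizing k m with
  | _ d ih =>
  subst hd
  by_cases hz : ∃ z, k < z ∧ z < m ∧ p k < p z ∧ p z < p m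
  · obtain ⟨z, h₁, h₂, h₃, h₄⟩ := hz
    exact (ih _ (by omega) h₁ h₃ rfl).trans (ih _ (by omega) h₂ h₄ rfl)
  refine .single (directlyLeft_floorplan hn p ?_)
  push Not at hz
  refine (upper_le_lower p hkm hp).eq_of_not_lt fun hlt => ?_
  have hm := lower_le p m
  have hk := lt_upper p k
  obtain ⟨x, hx⟩ : ∃ x : Fin n, upper p k = x := ⟨⟨upper p k, by omega⟩, rfl⟩
  obtain ⟨y, hy⟩ : ∃ y : Fin n, lower p m = (y : ℕ) + 1 :=
    ⟨⟨lower p m - 1, by omega⟩, by simp only; omega⟩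
  obtain ⟨hkx, hx'⟩ := exists_of_upper_eq p hx
  obtain ⟨hym, hy'⟩ := exists_of_lower_eq p hy
  have outside : ∀ z, k < z → z < m → p z < p k ∨ p m < p z := by
    intro z h₁ h₂
    rcases lt_trichotomy (p z) (p k) with h | h | h
    · exact Or.inl h
    · exact absurd (p.injective h) h₁.ne'
    · exact Or.inr (lt_of_le_of_ne (hz z h₁ h₂ h) (p.injective.ne h₂.ne'))
  -- If the sides differed, then `x ≤ y < m`. The value at `x` is above `p m`, and a later drop
  -- would go from above `p m` to below `p k` in one step, which is the forbidden pattern. This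
  -- contradicts `p y < p m`.
  have above : ∀ z : ℕ, (x : ℕ) ≤ z → ∀ hz : z < m, p m < p ⟨z, by omega⟩ := by
    intro z hxz
    induction z, hxz using Nat.le_induction with
    | base => exact fun hxm => (outside x hkx hxm).resolve_left hx'.not_gt
    | succ z hxz ihz =>
      intro hzm
      have hkz : (k : ℕ) < z := lt_of_lt_of_le hkx hxz
      refine (outside ⟨z + 1, by omega⟩ (Nat.lt_succ_of_lt hkz) hzm).resolve_left fun hcon => ?_
      exact h k m ⟨z, by omega⟩ ⟨z + 1, by omega⟩ hkz rfl hzm hp hcon (ihz (by omega))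
  exact (hy'.trans (above y (by omega) hym)).false

theorem above_floorplan (hn : 0 < n) {p : Equiv.Perm (Fin n)} (h : AvoidsAscent (rev p))
    {k m : Fin n} (hkm : k < m) (hp : p m < p k) : (floorplan hn p).toLayout.Above k m := by
  rw [← Layout.leftOf_transpose, transpose_toLayout_floorplan]
  exact leftOf_floorplan hn h hkm ((rev_lt_rev_iff p k m).2 hp)

/-- The relations between the rooms are now known for every pair; they force the top-left order to
be the diagonal order and the bottom-left order to be `π`. -/
theorem floorplan_correspondsTo (hn : 0 < n) {π : Equiv.Perm (Fin n)} (hπ : IsBaxter π) :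
    (floorplan hn π.symm).CorrespondsTo π := by
  obtain ⟨t, b, ht, hb⟩ := (floorplan hn π.symm).exists_deletionOrders
  have key : ∀ a c : Fin n, a < c → t.symm a < t.symm c ∧
      (b.symm a < b.symm c ↔ π.symm a < π.symm c) := by
    intro a c hac
    have h := (floorplan hn π.symm).leftOf_and_above_iff ht hb a c
    rw [MosaicFloorplan.leftOf_eq, MosaicFloorplan.above_eq] at h
    rcases lt_or_gt_of_ne (π.symm.injective.ne hac.ne) with hp | hp
    · have := h.1.1 (leftOf_floorplan hn (avoidsAscent_symm hπ) hac hp)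
      exact ⟨this.1, iff_of_true this.2 hp⟩
    · have := h.2.1 (above_floorplan hn (avoidsAscent_rev_symm hπ) hac hp)
      exact ⟨this.1, iff_of_false this.2.not_gt hp.not_gt⟩
  have ht' : t.symm = Equiv.refl _ := Equiv.Perm.eq_of_lt_iff_lt fun a c =>
    (show StrictMono t.symm from fun a c hac => (key a c hac).1).lt_iff_lt
  have hb' : b.symm = π.symm := Equiv.Perm.eq_of_lt_iff_lt fun a c => by
    rcases lt_trichotomy a c with h | rfl | h
    · exact (key a c h).2
    · simp
    · have h₁ := (key c a h).2
      have h₂ := b.symm.injective.ne h.ne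
      have h₃ := π.symm.injective.ne h.ne
      grind
  refine ⟨t, b, ht, hb, fun i => ?_⟩
  rw [ht', ← π.symm_symm, ← hb']
  rfl

end PermFloorplan

theorem theorem8 (n : ℕ) (hn : 0 < n) (π : Equiv.Perm (Fin n)) (hπ : IsBaxter π) :
    ∃ f : MosaicFloorplan n,
      (∀ g : MosaicFloorplan n, g.CorrespondsTo π ↔ g.Equivalent f) ∧
      (∀ g : MosaicFloorplan n, g.CorrespondsTo π⁻¹ ↔ g.Equivalent f.mirror) := by
  have hf := PermFloorplan.floorplan_correspondsTo hn hπ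
  exact ⟨_, fun g => ⟨fun hg => hg.equivalent hf, fun hg => hg.correspondsTo hf⟩,
    fun g => ⟨fun hg => hg.equivalent hf.mirror, fun hg => hg.correspondsTo hf.mirror⟩⟩
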